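/- \textbf{Theorem} (The Robinson--Schensted correspondence via $\tau_g$). Let $n\ge 0$, let $S_n$ be the group of permutations of $\{1,\dots,n\}$ with $(xy)(k)=x(y(k))$, and let $s_i=(i\ \,i{+}1)$ for $1\le i\le n-1$; call $s_i,s_j$ adjacent if $|i-j|=1$. The one-line notation of $x\in S_n$ is $x(1)x(2)\cdots x(n)$. A standard tableau of size $n$ is a labelling of the boxes of a Young diagram (rows and columns top- and left-justified) having $n$ boxes with $1,\dots,n$, each used once, strictly increasing left-to-right along rows and top-to-bottom along columns; $\mathscr T_n$ is the set of all of them, of all shapes. For $x\in S_n$, let $\tau(x)$ be the set of simple transpositions $s_i$ with $s_ix<x$ in Bruhat order, where $x\le y$ means that $x$ is the product of a (not necessarily connected) subword of some minimal-length expression of $y$ in the $s_k$. For $Y\in\mathscr T_n$, let $\tau(Y)$ be the set of those $s_i$ for which $i+1$ lies in a row of $Y$ strictly below the row of $i$. For $\Omega=S_n$ or $\Omega=\mathscr T_n$ and adjacent $s_i,s_j$, let $D_{i,j}=\{\omega\in\Omega : s_i\in\tau(\omega),\ s_j\notin\tau(\omega)\}$. For $x\in D_{i,j}\subseteq S_n$,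 exactly one of $s_ix,\ s_jx$ lies in $D_{j,i}$; call it $f_{i,j}(x)$. For $Y\in D_{i,j}\subseteq\mathscr T_n$, exactly one of $s_i\cdot Y,\ s_j\cdot Y$ is a standard tableau in $D_{j,i}$, where $s_k\cdot Y$ is obtained by exchanging the labels $k$ and $k+1$; call it $f_{i,j}(Y)$. For $\omega,\omega'$, each an element of $S_n$ or of $\mathscr T_n$ (possibly one of each), say that $\omega$ and $\omega'$ are equivalent to order $0$ if $\tau(\omega)=\tau(\omega')$, and equivalent to order $m\ge 1$ if they are equivalent to order $m-1$ and, for all adjacent $s_i,s_j$ such that $\omega$ and $\omega'$ both lie in their sets $D_{i,j}$, the elements $f_{i,j}(\omega)$ and $f_{i,j}(\omega')$ are equivalent to order $m-1$. Write $\tau_g(\omega)=\tau_g(\omega')$ if they are equivalent to order $m$ for every $m\ge 0$. Let $P(x)$ and $Q(x)$ be the insertion tableau and the recording tableau obtained from $x\in S_n$ by the Robinson--Schensted algorithm: starting from empty tableaux, insert $x(1),x(2),\dots,x(n)$ in turn by row insertion (a number inserted into a row replaces the leftmost larger entry, which is then inserted into the next row, or is placed at the end of the row if there is no larger entry); $Q(x)$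 has label $k$ in the box added at the $k$-th step. Then for every $x\in S_n$: $P(x)$ satisfies $\tau_g(P(x))=\tau_g(x)$ and is the only element of $\mathscr T_n$ that does; and $Q(x)$ satisfies $\tau_g(Q(x))=\tau_g(x^{-1})$ and is the only element of $\mathscr T_n$ that does. -/

import Mathlib

namespace RSTau

/-! Throughout, `Fin n = {0, …, n - 1}` stands for `{1, …, n}` (via `k ↦ k + 1`), and
`S_n = Equiv.Perm (Fin n)` with `(x * y) k = x (y k)`.  The simple transpositions
`s_1, …, s_{n-1}` are indexed by `Fin (n - 1)` in the same way. -/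

/-! ### Simple transpositions -/

/-- The number `i`, as one of the `n` letters. -/
def lo {n : ℕ} (i : Fin (n - 1)) : Fin n := ⟨i.1, by omega⟩

/-- The number `i + 1`, as one of the `n` letters. -/
def hi {n : ℕ} (i : Fin (n - 1)) : Fin n := ⟨i.1 + 1, by omega⟩

/-- The simple transposition `s_i`, exchanging `i` and `i + 1`. -/
def s {n : ℕ} (i : Fin (n - 1)) : Equiv.Perm (Fin n) := Equiv.swap (lo i) (hi i)

/-- `s_i` and `s_j` are adjacent simple transpositions. -/
def Adjacent {n : ℕ} (i j : Fin (n - 1)) : Prop := i.1 + 1 = j.1 ∨ j.1 + 1 = i.1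

/-! ### Generalized `τ`-invariants -/

/-- `D_{i,j}`: the elements `ω` with `s_i ∈ τ(ω)` and `s_j ∉ τ(ω)`. -/
def D {n : ℕ} {Ω : Type} (τ : Ω → Set (Fin (n - 1))) (i j : Fin (n - 1)) : Set Ω :=
  {ω | i ∈ τ ω ∧ j ∉ τ ω}

/-- The data needed to speak of generalized `τ`-invariants of the elements of a set `Ω`:
a `τ`-invariant (a set of simple transpositions) and maps `f_{i,j} : D_{i,j} → D_{j,i}`. -/
structure TauSystem (n : ℕ) (Ω : Type) where
  τ : Ω → Set (Fin (n - 1))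
  f : ∀ i j : Fin (n - 1), Adjacent i j → D τ i j → D τ j i

/-- `ω` and `ω'` (elements of two possibly different sets) are equivalent to order `m`. -/
def EquivToOrder {n : ℕ} {Ω Ω' : Type} (A : TauSystem n Ω) (B : TauSystem n Ω') :
    ℕ → Ω → Ω' → Prop
  | 0, ω, ω' => A.τ ω = B.τ ω'
  | m + 1, ω, ω' => EquivToOrder A B m ω ω' ∧
      ∀ (i j : Fin (n - 1)) (hij : Adjacent i j) (h : ω ∈ D A.τ i j) (h' : ω' ∈ D B.τ i j),
        EquivToOrder A B m (A.f i j hij ⟨ω, h⟩).1 (B.f i j hij ⟨ω', h'⟩).1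

/-- `τ_g(ω) = τ_g(ω')`: the elements `ω` and `ω'` are equivalent to every order. -/
def SameGenTau {n : ℕ} {Ω Ω' : Type} (A : TauSystem n Ω) (B : TauSystem n Ω')
    (ω : Ω) (ω' : Ω') : Prop :=
  ∀ m : ℕ, EquivToOrder A B m ω ω'

/-! ### The symmetric group -/

/-- The product `s_{i_1} ⋯ s_{i_k}` of a word in the simple transpositions. -/
def wordProd {n : ℕ} (l : List (Fin (n - 1))) : Equiv.Perm (Fin n) := (l.map s).prod

/-- `l` is a minimal-length expression for `x` in the simple transpositions. -/
def IsMinimalExpression {n : ℕ} (l : List (Fin (n - 1))) (x : Equiv.Perm (Fin n)) : Prop :=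
  wordProd l = x ∧ ∀ l' : List (Fin (n - 1)), wordProd l' = x → l.length ≤ l'.length

/-- Bruhat order: `x ≤ y` if `x` is a (not necessarily connected) subword of a minimal-length
expression for `y`. -/
def BruhatLE {n : ℕ} (x y : Equiv.Perm (Fin n)) : Prop :=
  ∃ l, IsMinimalExpression l y ∧ ∃ l', l'.Sublist l ∧ wordProd l' = x

/-- The `τ`-invariant of a permutation: the `s_i` with `s_i x < x` in Bruhat order. -/
def permTau {n : ℕ} (x : Equiv.Perm (Fin n)) : Set (Fin (n - 1)) :=
  {i | BruhatLE (s i * x) x ∧ s i * x ≠ x}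

theorem lo_lt_hi {n : ℕ} (i : Fin (n - 1)) : lo i < hi i := by
  simp [lo, hi, Fin.lt_def]

theorem lo_ne_hi {n : ℕ} (i : Fin (n - 1)) : lo i ≠ hi i := (lo_lt_hi i).ne

theorem s_mul_ne {n : ℕ} (i : Fin (n - 1)) (x : Equiv.Perm (Fin n)) : s i * x ≠ x := by
  intro h
  have h1 : s i = 1 := mul_eq_right.mp h
  have h2 : s i (lo i) = lo i := by rw [h1]; rfl
  rw [s, Equiv.swap_apply_left] at h2
  exact lo_ne_hi i h2.symm

theorem s_mul_s {n : ℕ} (i : Fin (n - 1)) (x : Equiv.Perm (Fin n)) : s i * (s i * x) = x := by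
  rw [← mul_assoc, s, Equiv.swap_mul_self, one_mul]

theorem wordProd_cons {n : ℕ} (i : Fin (n - 1)) (l : List (Fin (n - 1))) :
    wordProd (i :: l) = s i * wordProd l := by
  simp [wordProd]

theorem s_inv {n : ℕ} (i : Fin (n - 1)) : (s i)⁻¹ = s i := by simp [s]

theorem inv_apply_lo {n : ℕ} (i : Fin (n - 1)) (x : Equiv.Perm (Fin n)) :
    (s i * x)⁻¹ (lo i) = x⁻¹ (hi i) := by
  rw [mul_inv_rev, s_inv, Equiv.Perm.mul_apply, s, Equiv.swap_apply_left]

theorem inv_apply_hi {n : ℕ} (i : Fin (n - 1)) (x : Equiv.Perm (Fin n)) :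
    (s i * x)⁻¹ (hi i) = x⁻¹ (lo i) := by
  rw [mul_inv_rev, s_inv, Equiv.Perm.mul_apply, s, Equiv.swap_apply_right]

theorem inv_apply_of_ne {n : ℕ} (i : Fin (n - 1)) (x : Equiv.Perm (Fin n)) (k : Fin n)
    (h1 : k ≠ lo i) (h2 : k ≠ hi i) : (s i * x)⁻¹ k = x⁻¹ k := by
  rw [mul_inv_rev, s_inv, Equiv.Perm.mul_apply, s, Equiv.swap_apply_of_ne_of_ne h1 h2]

/-- The pairs of values of `x` that appear in the wrong order in one-line notation. -/
def invSet {n : ℕ} (x : Equiv.Perm (Fin n)) : Finset (Fin n × Fin n) :=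
  {p | p.1 < p.2 ∧ x⁻¹ p.2 < x⁻¹ p.1}

theorem s_lt_s {n : ℕ} (i : Fin (n - 1)) {a b : Fin n} (h : a < b)
    (hne : (a, b) ≠ (lo i, hi i)) : s i a < s i b := by
  simp only [s, Equiv.swap_apply_def, lo, hi, ne_eq, Prod.mk.injEq, Fin.ext_iff, Fin.lt_def] at *
  split_ifs <;> simp_all <;> omega

theorem card_invSet_s_mul {n : ℕ} (i : Fin (n - 1)) (x : Equiv.Perm (Fin n))
    (h : x⁻¹ (lo i) < x⁻¹ (hi i)) : (invSet (s i * x)).card = (invSet x).card + 1 := by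
  have hmem : (lo i, hi i) ∉ (invSet x).map ((s i).prodCongr (s i)).toEmbedding := by
    simp only [Finset.mem_map_equiv, invSet, Finset.mem_filter, not_and]
    intro _ h1
    simp only [Equiv.prodCongr_symm, Equiv.prodCongr_apply, Prod.map] at h1
    have : (s i).symm = s i := s_inv i
    rw [this, s, Equiv.swap_apply_left, Equiv.swap_apply_right] at h1
    exact absurd h1 (lo_lt_hi i).not_gt
  have : invSet (s i * x) =
      insert (lo i, hi i) ((invSet x).map ((s i).prodCongr (s i)).toEmbedding) := by
    ext ⟨a, b⟩
    have hs : (s i).symm = s i := s_inv i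
    have hss : ∀ a, s i (s i a) = a := fun a => by
      rw [s, ← Equiv.Perm.mul_apply, Equiv.swap_mul_self]; rfl
    have hx : ∀ a, (s i * x)⁻¹ a = x⁻¹ (s i a) := fun a => by
      rw [mul_inv_rev, s_inv, Equiv.Perm.mul_apply]
    simp only [invSet, Finset.mem_insert, Finset.mem_map_equiv, Finset.mem_filter,
      Finset.mem_univ, true_and, Equiv.prodCongr_symm, Equiv.prodCongr_apply, Prod.map, hs, hx]
    by_cases hab : (a, b) = (lo i, hi i)
    · simp only [hab, true_or, iff_true]
      obtain ⟨rfl, rfl⟩ := Prod.mk.inj hab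
      refine ⟨lo_lt_hi i, ?_⟩
      simpa [s] using h
    · simp only [hab, false_or]
      refine and_congr_left fun _ => ⟨fun h => s_lt_s i h hab, fun h' => ?_⟩
      have hne : (s i a, s i b) ≠ (lo i, hi i) := by
        intro he
        obtain ⟨h1, h2⟩ := Prod.mk.inj he
        have e1 : a = hi i := by rw [← hss a, h1, s, Equiv.swap_apply_left]
        have e2 : b = lo i := by rw [← hss b, h2, s, Equiv.swap_apply_right]
        subst e1 e2
        simp only [s, Equiv.swap_apply_left, Equiv.swap_apply_right] at *
        rename_i hh
        exact absurd h hh.not_gt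
      simpa [hss] using s_lt_s i h' hne
  rw [this, Finset.card_insert_of_notMem hmem, Finset.card_map]

theorem inv_lo_ne_hi {n : ℕ} (i : Fin (n - 1)) (x : Equiv.Perm (Fin n)) :
    x⁻¹ (lo i) ≠ x⁻¹ (hi i) := fun h => lo_ne_hi i (x⁻¹.injective h)

theorem card_invSet_of_gt {n : ℕ} (i : Fin (n - 1)) (x : Equiv.Perm (Fin n))
    (h : x⁻¹ (hi i) < x⁻¹ (lo i)) : (invSet x).card = (invSet (s i * x)).card + 1 := by
  have := card_invSet_s_mul i (s i * x) (by rwa [inv_apply_lo, inv_apply_hi])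
  rwa [s_mul_s] at this

theorem card_invSet_wordProd_le {n : ℕ} (l : List (Fin (n - 1))) :
    (invSet (wordProd l)).card ≤ l.length := by
  induction l with
  | nil =>
    simp only [wordProd, List.map_nil, List.prod_nil, List.length_nil, nonpos_iff_eq_zero,
      Finset.card_eq_zero, invSet, Finset.filter_eq_empty_iff, inv_one, Equiv.Perm.one_apply]
    exact fun p _ h => absurd h.1 h.2.not_gt
  | cons i l ih =>
    rw [wordProd_cons, List.length_cons]
    rcases lt_or_gt_of_ne (inv_lo_ne_hi i (wordProd l)) with h | h
    · rw [card_invSet_s_mul i _ h]; omega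
    · have := card_invSet_of_gt i _ h; omega

theorem eq_one_of_forall_lt {n : ℕ} (x : Equiv.Perm (Fin n))
    (h : ∀ i, x⁻¹ (lo i) < x⁻¹ (hi i)) : x = 1 := by
  rcases n with _ | n
  · exact Subsingleton.elim _ _
  · have hm : StrictMono (x⁻¹ : Equiv.Perm (Fin (n + 1))) :=
      Fin.strictMono_iff_lt_succ.mpr fun i => h i
    have : x⁻¹ = 1 := by
      ext k
      have := congrArg (fun e : Fin (n + 1) ≃o Fin (n + 1) => e k)
        (Subsingleton.elim (hm.orderIsoOfSurjective _ x⁻¹.surjective) (OrderIso.refl _))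
      simpa using congrArg Fin.val this
    exact inv_eq_one.mp this

theorem exists_word {n : ℕ} (m : ℕ) : ∀ x : Equiv.Perm (Fin n), (invSet x).card = m →
    ∃ l, wordProd l = x ∧ l.length = m := by
  induction m with
  | zero =>
    intro x hx
    refine ⟨[], ?_, rfl⟩
    have : x = 1 := eq_one_of_forall_lt x fun i => by
      rcases lt_or_gt_of_ne (inv_lo_ne_hi i x) with h | h
      · exact h
      · have := card_invSet_of_gt i x h; omega
    simp [this, wordProd]
  | succ m ih =>
    intro x hx
    by_cases h : ∀ i, x⁻¹ (lo i) < x⁻¹ (hi i)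
    · have h1 := eq_one_of_forall_lt x h
      have h2 := card_invSet_wordProd_le (n := n) []
      simp only [wordProd, List.map_nil, List.prod_nil, List.length_nil] at h2
      rw [h1] at hx; omega
    · push Not at h
      obtain ⟨i, hi'⟩ := h
      have := card_invSet_of_gt i x (lt_of_le_of_ne hi' (inv_lo_ne_hi i x).symm)
      obtain ⟨l, hl, hlen⟩ := ih (s i * x) (by omega)
      exact ⟨i :: l, by rw [wordProd_cons, hl, s_mul_s], by simp [hlen]⟩

/-- `s_i ∈ τ(x)` iff `i + 1` appears to the left of `i` in the one-line notation of `x`. -/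
theorem mem_permTau {n : ℕ} (i : Fin (n - 1)) (x : Equiv.Perm (Fin n)) :
    i ∈ permTau x ↔ x⁻¹ (hi i) < x⁻¹ (lo i) := by
  constructor
  · rintro ⟨⟨l, ⟨hl, hmin⟩, l', hsub, hl'⟩, -⟩
    rcases lt_or_gt_of_ne (inv_lo_ne_hi i x) with h | h
    · exfalso
      have h1 := card_invSet_s_mul i x h
      have h2 := card_invSet_wordProd_le l'
      obtain ⟨l'', hl'', hlen⟩ := exists_word _ x rfl
      have h3 := hmin l'' hl''
      have h4 := hsub.length_le
      rw [hl'] at h2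
      omega
    · exact h
  · intro h
    refine ⟨?_, s_mul_ne i x⟩
    have h1 := card_invSet_of_gt i x h
    obtain ⟨l, hl, hlen⟩ := exists_word _ (s i * x) rfl
    have hw : wordProd (i :: l) = x := by rw [wordProd_cons, hl, s_mul_s]
    refine ⟨i :: l, ⟨hw, fun l' hl' => ?_⟩, l, List.sublist_cons_self i l, hl⟩
    have := card_invSet_wordProd_le l'
    rw [hl'] at this
    simp only [List.length_cons]
    omega

theorem existsUnique_perm {n : ℕ} {i j : Fin (n - 1)} (hij : Adjacent i j)
    (x : D (permTau (n := n)) i j) :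
    ∃! y : Equiv.Perm (Fin n), y ∈ D permTau j i ∧ (y = s i * x.1 ∨ y = s j * x.1) := by
  obtain ⟨x, hx1, hx2⟩ := x
  rw [mem_permTau] at hx1 hx2
  rcases hij with hij | hij
  · have e : lo j = hi i := Fin.ext hij.symm
    have n1 : hi j ≠ lo i := by simp [lo, hi, Fin.ext_iff]; omega
    have n2 : hi j ≠ hi i := by simp [hi, Fin.ext_iff]; omega
    have n3 : lo i ≠ hi j := n1.symm
    have n4 : lo i ≠ lo j := by rw [e]; exact lo_ne_hi i
    have hne : x⁻¹ (lo i) ≠ x⁻¹ (hi j) := fun h => n3 (x⁻¹.injective h)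
    have A : s i * x ∈ D permTau j i ↔ x⁻¹ (hi j) < x⁻¹ (lo i) := by
      simp only [D, Set.mem_ofPred_eq, mem_permTau]
      rw [e, inv_apply_hi, inv_apply_lo, inv_apply_of_ne i x _ n1 n2]
      exact ⟨fun h => h.1, fun h => ⟨h, hx1.not_gt⟩⟩
    have B : s j * x ∈ D permTau j i ↔ x⁻¹ (lo i) < x⁻¹ (hi j) := by
      simp only [D, Set.mem_ofPred_eq, mem_permTau]
      rw [← e, inv_apply_hi, inv_apply_lo, inv_apply_of_ne j x _ n4 n3]
      have : x⁻¹ (lo j) < x⁻¹ (hi j) := lt_of_le_of_ne (not_lt.mp hx2) (inv_lo_ne_hi j x)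
      exact ⟨fun h => lt_of_le_of_ne (not_lt.mp h.2) hne, fun h => ⟨this, h.not_gt⟩⟩
    rcases lt_or_gt_of_ne hne with h | h
    · refine ⟨s j * x, ⟨B.mpr h, Or.inr rfl⟩, ?_⟩
      rintro y ⟨hy, rfl | rfl⟩
      · exact absurd (A.mp hy) h.not_gt
      · rfl
    · refine ⟨s i * x, ⟨A.mpr h, Or.inl rfl⟩, ?_⟩
      rintro y ⟨hy, rfl | rfl⟩
      · rfl
      · exact absurd (B.mp hy) h.not_gt
  · have e : lo i = hi j := Fin.ext hij.symm
    have n1 : hi i ≠ lo j := by simp [lo, hi, Fin.ext_iff]; omega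
    have n2 : hi i ≠ hi j := by simp [hi, Fin.ext_iff]; omega
    have n3 : lo j ≠ hi i := n1.symm
    have n4 : lo j ≠ lo i := by rw [e]; exact lo_ne_hi j
    have hne : x⁻¹ (lo j) ≠ x⁻¹ (hi i) := fun h => n3 (x⁻¹.injective h)
    have hx2' : x⁻¹ (lo j) < x⁻¹ (hi j) := lt_of_le_of_ne (not_lt.mp hx2) (inv_lo_ne_hi j x)
    have A : s j * x ∈ D permTau j i ↔ x⁻¹ (lo j) < x⁻¹ (hi i) := by
      simp only [D, Set.mem_ofPred_eq, mem_permTau]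
      rw [e, inv_apply_hi, inv_apply_lo, inv_apply_of_ne j x _ n1 n2]
      exact ⟨fun h => lt_of_le_of_ne (not_lt.mp h.2) hne, fun h => ⟨hx2', h.not_gt⟩⟩
    have B : s i * x ∈ D permTau j i ↔ x⁻¹ (hi i) < x⁻¹ (lo j) := by
      simp only [D, Set.mem_ofPred_eq, mem_permTau]
      rw [← e, inv_apply_hi, inv_apply_lo, inv_apply_of_ne i x _ n4 n3]
      exact ⟨fun h => h.1, fun h => ⟨h, hx1.not_gt⟩⟩
    rcases lt_or_gt_of_ne hne with h | h
    · refine ⟨s j * x, ⟨A.mpr h, Or.inr rfl⟩, ?_⟩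
      rintro y ⟨hy, rfl | rfl⟩
      · exact absurd (B.mp hy) h.not_gt
      · rfl
    · refine ⟨s i * x, ⟨B.mpr h, Or.inl rfl⟩, ?_⟩
      rintro y ⟨hy, rfl | rfl⟩
      · rfl
      · exact absurd (A.mp hy) h.not_gt

/-- The `τ`-invariant on `S_n`, and `f_{i,j}(x)`, the unique one of `s_i x`, `s_j x` in
`D_{j,i}`. -/
noncomputable def permSystem (n : ℕ) : TauSystem n (Equiv.Perm (Fin n)) where
  τ := permTau
  f _ _ hij x := ⟨(existsUnique_perm hij x).choose, (existsUnique_perm hij x).choose_spec.1.1⟩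

/-! ### Standard Young tableaux -/

/-- A bijective labelling of the boxes of a Young diagram with `n` boxes by `n` letters.
The box `(r, c)` is the one in row `r` and column `c`; rows are numbered downward and columns
rightward, from `0`. -/
structure Tableau (n : ℕ) where
  shape : YoungDiagram
  label : {b : ℕ × ℕ // b ∈ shape} ≃ Fin n

/-- The box with label `k`. -/
def Tableau.box {n : ℕ} (T : Tableau n) (k : Fin n) : ℕ × ℕ := (T.label.symm k).1

/-- The tableau obtained from `T` by applying the permutation `g` to its labels. -/
def Tableau.relabel {n : ℕ} (g : Equiv.Perm (Fin n)) (T : Tableau n) : Tableau n :=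
  ⟨T.shape, T.label.trans g⟩

/-- A standard Young tableau with `n` boxes: the labels increase strictly left-to-right along
rows and top-to-bottom along columns. -/
structure StandardTableau (n : ℕ) extends Tableau n where
  row_strict : ∀ b b' : {b : ℕ × ℕ // b ∈ shape},
    b.1.1 = b'.1.1 → b.1.2 < b'.1.2 → label b < label b'
  col_strict : ∀ b b' : {b : ℕ × ℕ // b ∈ shape},
    b.1.2 = b'.1.2 → b.1.1 < b'.1.1 → label b < label b'

/-- The `τ`-invariant of a standard tableau: the `s_i` such that `i + 1` is in a row strictly
below the row of `i`. -/
def tableauTau {n : ℕ} (Y : StandardTableau n) : Set (Fin (n - 1)) :=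
  {i | (Y.box (lo i)).1 < (Y.box (hi i)).1}

theorem StandardTableau.eq_of_toTableau {n : ℕ} {Y Z : StandardTableau n}
    (h : Y.toTableau = Z.toTableau) : Y = Z := by
  cases Y; cases Z; cases h; rfl

theorem Tableau.box_injective {n : ℕ} (T : Tableau n) : Function.Injective T.box :=
  fun _ _ h => T.label.symm.injective (Subtype.ext h)

theorem Tableau.box_mem {n : ℕ} (T : Tableau n) (k : Fin n) : T.box k ∈ T.shape :=
  (T.label.symm k).2

theorem Tableau.box_label {n : ℕ} (T : Tableau n) (b : {b : ℕ × ℕ // b ∈ T.shape}) :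
    T.box (T.label b) = b.1 := by simp [Tableau.box]

theorem Tableau.exists_label {n : ℕ} (T : Tableau n) {b : ℕ × ℕ} (h : b ∈ T.shape) :
    ∃ k, T.box k = b := ⟨T.label ⟨b, h⟩, T.box_label _⟩

theorem Tableau.box_relabel {n : ℕ} (g : Equiv.Perm (Fin n)) (T : Tableau n) (k : Fin n) :
    (T.relabel g).box k = T.box (g⁻¹ k) := rfl

theorem StandardTableau.le_of_box_le {n : ℕ} (Y : StandardTableau n) {a b : Fin n}
    (h1 : (Y.box a).1 ≤ (Y.box b).1) (h2 : (Y.box a).2 ≤ (Y.box b).2) : a ≤ b := by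
  have hm : ((Y.box a).1, (Y.box b).2) ∈ Y.shape := Y.shape.up_left_mem h1 le_rfl (Y.box_mem b)
  have ha : Y.label ⟨Y.box a, Y.box_mem a⟩ = a := by simp [Tableau.box]
  have hb : Y.label ⟨Y.box b, Y.box_mem b⟩ = b := by simp [Tableau.box]
  have e1 : Y.label ⟨Y.box a, Y.box_mem a⟩ ≤ Y.label ⟨_, hm⟩ := by
    rcases h2.lt_or_eq with h | h
    · exact (Y.row_strict ⟨Y.box a, Y.box_mem a⟩ ⟨_, hm⟩ rfl h).le
    · exact le_of_eq (congrArg _ (Subtype.ext (Prod.ext rfl h)))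
  have e2 : Y.label ⟨_, hm⟩ ≤ Y.label ⟨Y.box b, Y.box_mem b⟩ := by
    rcases h1.lt_or_eq with h | h
    · exact (Y.col_strict ⟨_, hm⟩ ⟨Y.box b, Y.box_mem b⟩ rfl h).le
    · exact le_of_eq (congrArg _ (Subtype.ext (Prod.ext h rfl)))
  rw [ha] at e1
  rw [hb] at e2
  exact e1.trans e2

/-- If `i` and `i + 1` share neither a row nor a column of `Y`, then `s_i · Y` is standard. -/
def StandardTableau.swap {n : ℕ} (Y : StandardTableau n) (i : Fin (n - 1))
    (hr : (Y.box (lo i)).1 ≠ (Y.box (hi i)).1) (hc : (Y.box (lo i)).2 ≠ (Y.box (hi i)).2) :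
    StandardTableau n where
  toTableau := Y.relabel (s i)
  row_strict b b' h1 h2 := by
    refine s_lt_s i (Y.row_strict b b' h1 h2) fun h => hr ?_
    have e1 := Y.box_label b
    have e2 := Y.box_label b'
    rw [(Prod.mk.inj h).1] at e1
    rw [(Prod.mk.inj h).2] at e2
    rw [e1, e2]
    exact h1
  col_strict b b' h1 h2 := by
    refine s_lt_s i (Y.col_strict b b' h1 h2) fun h => hc ?_
    have e1 := Y.box_label b
    have e2 := Y.box_label b'
    rw [(Prod.mk.inj h).1] at e1
    rw [(Prod.mk.inj h).2] at e2
    rw [e1, e2]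
    exact h1

theorem box_lo_of_eq {n : ℕ} {Y Z : StandardTableau n} {i : Fin (n - 1)}
    (h : Z.toTableau = Y.relabel (s i)) : Z.box (lo i) = Y.box (hi i) := by
  rw [h, Tableau.box_relabel, s_inv, s, Equiv.swap_apply_left]

theorem box_hi_of_eq {n : ℕ} {Y Z : StandardTableau n} {i : Fin (n - 1)}
    (h : Z.toTableau = Y.relabel (s i)) : Z.box (hi i) = Y.box (lo i) := by
  rw [h, Tableau.box_relabel, s_inv, s, Equiv.swap_apply_right]

theorem box_of_ne_of_eq {n : ℕ} {Y Z : StandardTableau n} {i : Fin (n - 1)}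
    (h : Z.toTableau = Y.relabel (s i)) {k : Fin n} (h1 : k ≠ lo i) (h2 : k ≠ hi i) :
    Z.box k = Y.box k := by
  rw [h, Tableau.box_relabel, s_inv, s, Equiv.swap_apply_of_ne_of_ne h1 h2]

/-- Geometry of three consecutive labels `i`, `i + 1`, `i + 2` of a standard tableau. -/
theorem box_facts {n : ℕ} (Y : StandardTableau n) {a b c : Fin n}
    (hab : a.1 + 1 = b.1) (hbc : b.1 + 1 = c.1) :
    ((Y.box a).1 < (Y.box b).1 → (Y.box a).1 < (Y.box c).1 → (Y.box c).1 ≤ (Y.box b).1 →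
      (Y.box a).2 ≠ (Y.box b).2) ∧
    ((Y.box b).1 ≤ (Y.box a).1 → (Y.box a).1 < (Y.box c).1 → (Y.box b).2 ≠ (Y.box c).2) := by
  have key : ∀ k : Fin n, a < k → k < c → k = b := fun k h1 h2 => by
    simp only [Fin.lt_def, Fin.ext_iff] at *; omega
  have nle : ∀ k l : Fin n, k < l → (Y.box l).1 ≤ (Y.box k).1 → (Y.box k).2 < (Y.box l).2 :=
    fun k l hkl h => by
      by_contra hh
      exact absurd (Y.le_of_box_le h (not_lt.mp hh)) (not_le.mpr hkl)
  have lab : a < b := by rw [Fin.lt_def]; omega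
  have lbc : b < c := by rw [Fin.lt_def]; omega
  have lac : a < c := lab.trans lbc
  have strict : ∀ k l : Fin n, (Y.box k).1 ≤ (Y.box l).1 → (Y.box k).2 ≤ (Y.box l).2 →
      Y.box k ≠ Y.box l → k < l := fun k l h1 h2 h3 =>
    lt_of_le_of_ne (Y.le_of_box_le h1 h2) fun h => h3 (by rw [h])
  constructor
  · intro h1 h2 h3 h4
    have h5 := nle b c lbc h3
    have hm : ((Y.box a).1, (Y.box c).2) ∈ Y.shape := Y.shape.up_left_mem h2.le le_rfl (Y.box_mem c)
    obtain ⟨k, hk⟩ := Y.exists_label hm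
    have k1 : a < k := strict _ _ (by simp [hk]) (by simp only [hk]; omega) fun h => by
      rw [hk] at h; have := congrArg Prod.snd h; simp only at this; omega
    have k2 : k < c := strict _ _ (by simp only [hk]; omega) (by simp [hk]) fun h => by
      rw [hk] at h; have := congrArg Prod.fst h; simp only at this; omega
    have := key k k1 k2
    rw [this] at hk
    have := congrArg Prod.fst hk
    simp only at this
    omega
  · intro h1 h2 h3
    have h5 := nle a b lab h1
    have hle : (Y.box a).2 ≤ (Y.box c).2 := by omega
    have hm : ((Y.box c).1, (Y.box a).2) ∈ Y.shape :=
      Y.shape.up_left_mem le_rfl hle (Y.box_mem c)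
    obtain ⟨k, hk⟩ := Y.exists_label hm
    have k1 : a < k := strict _ _ (by simp only [hk]; omega) (by simp [hk]) fun h => by
      rw [hk] at h; have := congrArg Prod.fst h; simp only at this; omega
    have k2 : k < c := strict _ _ (by simp [hk]) (by simp only [hk]; omega) fun h => by
      rw [hk] at h; have := congrArg Prod.snd h; simp only at this; omega
    have := key k k1 k2
    rw [this] at hk
    have := congrArg Prod.fst hk
    simp only at this
    omega

theorem existsUnique_tableau {n : ℕ} {i j : Fin (n - 1)} (hij : Adjacent i j)
    (Y : D (tableauTau (n := n)) i j) :
    ∃! Z : StandardTableau n, Z ∈ D tableauTau j i ∧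
      (Z.toTableau = Y.1.relabel (s i) ∨ Z.toTableau = Y.1.relabel (s j)) := by
  obtain ⟨Y, hY1, hY2⟩ := Y
  simp only [tableauTau, Set.mem_ofPred_eq, not_lt] at hY1 hY2
  have col : ∀ k l : Fin n, k < l → (Y.box l).1 < (Y.box k).1 → (Y.box k).2 ≠ (Y.box l).2 :=
    fun k l hkl h hh => absurd (Y.le_of_box_le h.le hh.ge) (not_le.mpr hkl)
  rcases hij with hij | hij
  · have e : lo j = hi i := Fin.ext hij.symm
    have n1 : hi j ≠ lo i := by simp [lo, hi, Fin.ext_iff]; omega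
    have n2 : hi j ≠ hi i := by simp [hi, Fin.ext_iff]; omega
    have n3 : lo i ≠ hi j := n1.symm
    have n4 : lo i ≠ lo j := by rw [e]; exact lo_ne_hi i
    have facts := (box_facts Y (a := lo i) (b := hi i) (c := hi j) rfl (by simp [hi]; omega)).1
    have A : ∀ Z : StandardTableau n, Z.toTableau = Y.relabel (s i) →
        (Z ∈ D tableauTau j i ↔ (Y.box (lo i)).1 < (Y.box (hi j)).1) := fun Z hZ => by
      simp only [D, tableauTau, Set.mem_ofPred_eq, not_lt]
      rw [e, box_hi_of_eq hZ, box_lo_of_eq hZ, box_of_ne_of_eq hZ n1 n2]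
      exact ⟨fun h => h.1, fun h => ⟨h, hY1.le⟩⟩
    have B : ∀ Z : StandardTableau n, Z.toTableau = Y.relabel (s j) →
        (Z ∈ D tableauTau j i ↔ (Y.box (hi j)).1 ≤ (Y.box (lo i)).1) := fun Z hZ => by
      simp only [D, tableauTau, Set.mem_ofPred_eq, not_lt]
      rw [← e, box_hi_of_eq hZ, box_lo_of_eq hZ, box_of_ne_of_eq hZ n4 n3]
      rw [← e] at hY1
      exact ⟨fun h => h.2, fun h => ⟨by omega, h⟩⟩
    rw [e] at hY2
    rcases lt_or_ge (Y.box (lo i)).1 (Y.box (hi j)).1 with h | h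
    · refine ⟨Y.swap i hY1.ne (facts hY1 h hY2), ⟨(A _ rfl).mpr h, Or.inl rfl⟩, ?_⟩
      rintro Z ⟨hZ, hh | hh⟩
      · exact StandardTableau.eq_of_toTableau hh
      · exact absurd ((B _ hh).mp hZ) h.not_ge
    · have hlt : (Y.box (hi j)).1 < (Y.box (lo j)).1 := by rw [e]; omega
      refine ⟨Y.swap j hlt.ne' (col _ _ (lo_lt_hi j) hlt),
        ⟨(B _ rfl).mpr h, Or.inr rfl⟩, ?_⟩
      rintro Z ⟨hZ, hh | hh⟩
      · exact absurd ((A _ hh).mp hZ) h.not_gt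
      · exact StandardTableau.eq_of_toTableau hh
  · have e : lo i = hi j := Fin.ext hij.symm
    have n1 : hi i ≠ lo j := by simp [lo, hi, Fin.ext_iff]; omega
    have n2 : hi i ≠ hi j := by simp [hi, Fin.ext_iff]; omega
    have n3 : lo j ≠ hi i := n1.symm
    have n4 : lo j ≠ lo i := by rw [e]; exact lo_ne_hi j
    have facts := (box_facts Y (a := lo j) (b := hi j) (c := hi i) rfl (by simp [hi]; omega)).2
    have A : ∀ Z : StandardTableau n, Z.toTableau = Y.relabel (s j) →
        (Z ∈ D tableauTau j i ↔ (Y.box (hi i)).1 ≤ (Y.box (lo j)).1) := fun Z hZ => by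
      simp only [D, tableauTau, Set.mem_ofPred_eq, not_lt]
      rw [e, box_hi_of_eq hZ, box_lo_of_eq hZ, box_of_ne_of_eq hZ n1 n2]
      rw [e] at hY1
      exact ⟨fun h => h.2, fun h => ⟨by omega, h⟩⟩
    have B : ∀ Z : StandardTableau n, Z.toTableau = Y.relabel (s i) →
        (Z ∈ D tableauTau j i ↔ (Y.box (lo j)).1 < (Y.box (hi i)).1) := fun Z hZ => by
      simp only [D, tableauTau, Set.mem_ofPred_eq, not_lt]
      rw [← e, box_hi_of_eq hZ, box_lo_of_eq hZ, box_of_ne_of_eq hZ n4 n3]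
      exact ⟨fun h => h.1, fun h => ⟨h, hY1.le⟩⟩
    rcases lt_or_ge (Y.box (lo j)).1 (Y.box (hi i)).1 with h | h
    · have hc := facts hY2 h
      rw [← e] at hc
      refine ⟨Y.swap i hY1.ne hc, ⟨(B _ rfl).mpr h, Or.inl rfl⟩, ?_⟩
      rintro Z ⟨hZ, hh | hh⟩
      · exact StandardTableau.eq_of_toTableau hh
      · exact absurd ((A _ hh).mp hZ) h.not_ge
    · have hlt : (Y.box (hi j)).1 < (Y.box (lo j)).1 := by rw [← e]; omega
      refine ⟨Y.swap j hlt.ne' (col _ _ (lo_lt_hi j) hlt),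
        ⟨(A _ rfl).mpr h, Or.inr rfl⟩, ?_⟩
      rintro Z ⟨hZ, hh | hh⟩
      · exact absurd ((B _ hh).mp hZ) h.not_gt
      · exact StandardTableau.eq_of_toTableau hh

/-- The `τ`-invariant on standard tableaux, and `f_{i,j}(Y)`, the unique one of `s_i · Y`,
`s_j · Y` that is a standard tableau in `D_{j,i}`. -/
noncomputable def tableauSystem (n : ℕ) : TauSystem n (StandardTableau n) where
  τ := tableauTau
  f _ _ hij Y :=
    ⟨(existsUnique_tableau hij Y).choose, (existsUnique_tableau hij Y).choose_spec.1.1⟩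

/-! ### The Robinson–Schensted algorithm -/

/-- Insert `a` into a row: the leftmost entry larger than `a` is replaced by `a` and bumped out;
if there is none, `a` is placed at the end of the row. -/
def bump {n : ℕ} (a : Fin n) : List (Fin n) → List (Fin n) × Option (Fin n)
  | [] => ([a], none)
  | c :: r => if a < c then (a :: r, some c) else (c :: (bump a r).1, (bump a r).2)

/-- Insert `a` into the first of the rows `P`; an entry bumped out of a row is inserted into the
next row.  In `Q`, which has rows of the same lengths as `P`, the label `k` is written in the box
that has been added to `P`. The result is the new pair `(P, Q)`. -/
def insertRecord {n : ℕ} (k a : Fin n) :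
    List (List (Fin n)) → List (List (Fin n)) → List (List (Fin n)) × List (List (Fin n))
  | [], _ => ([[a]], [[k]])
  | r :: P, Q =>
    match bump a r with
    | (r', none) => (r' :: P, (Q.headD [] ++ [k]) :: Q.tail)
    | (r', some b) =>
      (r' :: (insertRecord k b P Q.tail).1, Q.headD [] :: (insertRecord k b P Q.tail).2)

/-- The rows of the pair `(P(x), Q(x))`: starting from the empty pair, the entries of the one-line
notation of `x` are inserted from left to right. -/
def rsRows {n : ℕ} (x : Equiv.Perm (Fin n)) : List (List (Fin n)) × List (List (Fin n)) :=
  (List.finRange n).foldl (fun PQ k => insertRecord k (x k) PQ.1 PQ.2) ([], [])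

/-- The second row is no longer than the first, and its entries are larger than those above. -/
def Above {n : ℕ} : List (Fin n) → List (Fin n) → Prop
  | _, [] => True
  | [], _ :: _ => False
  | a :: r, b :: t => a < b ∧ Above r t

/-- The rows `L` form a tableau with strictly increasing rows and columns. -/
structure IsStandardRows {n : ℕ} (L : List (List (Fin n))) : Prop where
  chain : L.IsChain Above
  sorted : ∀ r ∈ L, r.Pairwise (· < ·)

theorem above_iff {n : ℕ} (r t : List (Fin n)) : Above r t ↔
    t.length ≤ r.length ∧ ∀ (j : ℕ) (h : j < r.length) (h' : j < t.length), r[j] < t[j] := by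
  induction r generalizing t with
  | nil => cases t <;> simp [Above]
  | cons a r ih =>
    cases t with
    | nil => simp [Above]
    | cons b t =>
      simp only [Above, ih, List.length_cons, Nat.add_le_add_iff_right]
      constructor
      · rintro ⟨h1, h2, h3⟩
        refine ⟨h2, fun j h h' => ?_⟩
        cases j with
        | zero => simpa using h1
        | succ j => simpa using h3 j (by omega) (by omega)
      · rintro ⟨h2, h3⟩
        refine ⟨by simpa using h3 0 (by omega) (by omega), h2, fun j h h' => ?_⟩
        exact h3 (j + 1) (Nat.succ_lt_succ h) (Nat.succ_lt_succ h')

theorem Above.trans {n : ℕ} {r t u : List (Fin n)} (h : Above r t) (h' : Above t u) :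
    Above r u := by
  rw [above_iff] at *
  exact ⟨h'.1.trans h.1, fun j h1 h2 => (h.2 j h1 (by omega)).trans (h'.2 j (by omega) h2)⟩

theorem bump_perm {n : ℕ} (a : Fin n) (r : List (Fin n)) :
    ((bump a r).1 ++ (bump a r).2.toList).Perm (a :: r) := by
  induction r with
  | nil => simp [bump]
  | cons c r ih =>
    by_cases h : a < c
    · simp only [bump, h, if_true, Option.toList_some, List.cons_append]
      exact (List.perm_append_singleton c r).cons a
    · simp only [bump, h, if_false, List.cons_append]
      exact (ih.cons c).trans (List.Perm.swap a c r)

theorem mem_of_mem_bump {n : ℕ} {a b : Fin n} {r : List (Fin n)} (h : b ∈ (bump a r).1) :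
    b = a ∨ b ∈ r := by
  have := (bump_perm a r).subset (List.mem_append_left _ h)
  simpa using this

theorem mem_of_bump_eq {n : ℕ} {a b : Fin n} {r r' : List (Fin n)}
    (h : bump a r = (r', some b)) : b ∈ r ∧ a < b := by
  induction r generalizing r' with
  | nil => simp [bump] at h
  | cons c r ih =>
    by_cases hc : a < c
    · simp only [bump, hc, if_true, Prod.mk.injEq, Option.some.injEq] at h
      rw [← h.2]
      exact ⟨List.mem_cons_self, hc⟩
    · simp only [bump, hc, if_false, Prod.mk.injEq] at h
      have := ih (Prod.ext rfl h.2)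
      exact ⟨List.mem_cons_of_mem _ this.1, this.2⟩

theorem bump_sorted {n : ℕ} {a : Fin n} {r : List (Fin n)} (hr : r.Pairwise (· < ·))
    (ha : a ∉ r) : (bump a r).1.Pairwise (· < ·) := by
  induction r with
  | nil => simp [bump]
  | cons c r ih =>
    rw [List.pairwise_cons] at hr
    rw [List.mem_cons, not_or] at ha
    by_cases hc : a < c
    · simp only [bump, hc, if_true, List.pairwise_cons]
      exact ⟨fun b hb => hc.trans (hr.1 b hb), hr.2⟩
    · simp only [bump, hc, if_false, List.pairwise_cons]
      refine ⟨fun b hb => ?_, ih hr.2 ha.2⟩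
      rcases mem_of_mem_bump hb with rfl | hb
      · exact lt_of_le_of_ne (not_lt.mp hc) (Ne.symm ha.1)
      · exact hr.1 b hb

theorem above_bump_left {n : ℕ} (a : Fin n) {r t : List (Fin n)} (h : Above r t) :
    Above (bump a r).1 t := by
  induction r generalizing t with
  | nil =>
    cases t with
    | nil => simp [Above]
    | cons b t => exact absurd h (by simp [Above])
  | cons c r ih =>
    cases t with
    | nil => simp [Above]
    | cons b t =>
      simp only [Above] at h
      by_cases hc : a < c
      · simp only [bump, hc, if_true, Above]
        exact ⟨hc.trans h.1, h.2⟩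
      · simp only [bump, hc, if_false, Above]
        exact ⟨h.1, ih h.2⟩

theorem above_bump_bump {n : ℕ} {a b : Fin n} {r r' t : List (Fin n)} (hr : r.Pairwise (· < ·))
    (h : Above r t) (hb : bump a r = (r', some b)) : Above r' (bump b t).1 := by
  induction r generalizing t r' with
  | nil => simp [bump] at hb
  | cons c r ih =>
    rw [List.pairwise_cons] at hr
    by_cases hc : a < c
    · simp only [bump, hc, if_true, Prod.mk.injEq, Option.some.injEq] at hb
      obtain ⟨rfl, rfl⟩ := hb
      cases t with
      | nil => simpa [bump, Above] using hc
      | cons d t =>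
        simp only [Above] at h
        simpa [bump, h.1, Above, hc] using h.2
    · simp only [bump, hc, if_false, Prod.mk.injEq] at hb
      obtain ⟨rfl, hb⟩ := hb
      have hb' : bump a r = ((bump a r).1, some b) := Prod.ext rfl hb
      have hcb : c < b := hr.1 b (mem_of_bump_eq hb').1
      cases t with
      | nil => simpa [bump, Above] using hcb
      | cons d t =>
        simp only [Above] at h
        by_cases hbd : b < d
        · simp only [bump, hbd, if_true, Above]
          exact ⟨hcb, above_bump_left a h.2⟩
        · simp only [bump, hbd, if_false, Above]
          exact ⟨h.1, ih hr.2 h.2 hb'⟩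

theorem insertRecord_perm {n : ℕ} (k a : Fin n) (P Q : List (List (Fin n))) :
    (insertRecord k a P Q).1.flatten.Perm (a :: P.flatten) := by
  induction P generalizing a Q with
  | nil => simp [insertRecord]
  | cons r P ih =>
    have hp := bump_perm a r
    rcases h : bump a r with ⟨r', _ | b⟩
    · rw [h] at hp
      simp only [insertRecord, h, List.flatten_cons]
      simp only [Option.toList_none, List.append_nil] at hp
      exact hp.append_right _
    · rw [h] at hp
      simp only [insertRecord, h, List.flatten_cons]
      refine ((ih b Q.tail).append_left r').trans ?_
      have : (r' ++ b :: P.flatten) = (r' ++ [b]) ++ P.flatten := by simp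
      rw [this]
      exact hp.append_right _

theorem insertRecord_sorted {n : ℕ} (k a : Fin n) (P Q : List (List (Fin n)))
    (hP : ∀ r ∈ P, r.Pairwise (· < ·)) (hnd : (a :: P.flatten).Nodup) :
    ∀ r ∈ (insertRecord k a P Q).1, r.Pairwise (· < ·) := by
  induction P generalizing a Q with
  | nil => simp [insertRecord]
  | cons r P ih =>
    rw [List.flatten_cons, List.nodup_cons, List.mem_append, not_or, List.nodup_append] at hnd
    obtain ⟨⟨h1, h2⟩, h3, h4, h5⟩ := hnd
    have hs := bump_sorted (hP r List.mem_cons_self) h1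
    have hP' : ∀ t ∈ P, t.Pairwise (· < ·) := fun t ht => hP t (List.mem_cons_of_mem _ ht)
    rcases h : bump a r with ⟨r', _ | b⟩
    · rw [h] at hs
      simp only [insertRecord, h, List.mem_cons, forall_eq_or_imp]
      exact ⟨hs, hP'⟩
    · rw [h] at hs
      simp only [insertRecord, h, List.mem_cons, forall_eq_or_imp]
      refine ⟨hs, ih b _ hP' (List.nodup_cons.mpr ⟨fun hb => ?_, h4⟩)⟩
      exact h5 b (mem_of_bump_eq h).1 b hb rfl

theorem insertRecord_chain_cons {n : ℕ} (k a c : Fin n) (u u' : List (Fin n))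
    (P Q : List (List (Fin n))) (hP : ∀ r ∈ u :: P, r.Pairwise (· < ·))
    (hc : (u :: P).IsChain Above) (hu : bump c u = (u', some a)) :
    (u' :: (insertRecord k a P Q).1).IsChain Above := by
  induction P generalizing a c u u' Q with
  | nil =>
    simp only [insertRecord, List.isChain_cons_cons, List.isChain_singleton, and_true]
    exact above_bump_bump (t := []) (hP u List.mem_cons_self) (by simp [Above]) hu
  | cons r P ih =>
    rw [List.isChain_cons_cons] at hc
    have hur := above_bump_bump (hP u List.mem_cons_self) hc.1 hu
    have hP' : ∀ t ∈ r :: P, t.Pairwise (· < ·) := fun t ht => hP t (List.mem_cons_of_mem _ ht)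
    rcases h : bump a r with ⟨r', _ | b⟩
    · simp only [insertRecord, h, List.isChain_cons_cons]
      rw [h] at hur
      refine ⟨hur, ?_⟩
      cases P with
      | nil => simp
      | cons t P =>
        rw [List.isChain_cons_cons] at hc ⊢
        have := above_bump_left a hc.2.1
        rw [h] at this
        exact ⟨this, hc.2.2⟩
    · simp only [insertRecord, h, List.isChain_cons_cons]
      rw [h] at hur
      exact ⟨hur, ih b a r r' _ hP' hc.2 h⟩

theorem insertRecord_chain {n : ℕ} (k a : Fin n) (P Q : List (List (Fin n)))
    (hP : IsStandardRows P) : (insertRecord k a P Q).1.IsChain Above := by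
  cases P with
  | nil => simp [insertRecord]
  | cons r P =>
    have hc := hP.chain
    rcases h : bump a r with ⟨r', _ | b⟩
    · simp only [insertRecord, h]
      cases P with
      | nil => simp
      | cons t P =>
        rw [List.isChain_cons_cons] at hc ⊢
        have := above_bump_left a hc.1
        rw [h] at this
        exact ⟨this, hc.2⟩
    · simp only [insertRecord, h]
      exact insertRecord_chain_cons k b a r r' P _ hP.sorted hc h

theorem bump_length {n : ℕ} {a : Fin n} {r r' : List (Fin n)} {o : Option (Fin n)}
    (h : bump a r = (r', o)) : r'.length + o.toList.length = r.length + 1 := by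
  have := (bump_perm a r).length_eq
  rw [h] at this
  simpa using this

theorem insertRecord_shape {n : ℕ} (k a : Fin n) (P Q : List (List (Fin n)))
    (h : Q.map List.length = P.map List.length) :
    (insertRecord k a P Q).2.map List.length = (insertRecord k a P Q).1.map List.length := by
  induction P generalizing a Q with
  | nil => simp [insertRecord]
  | cons r P ih =>
    cases Q with
    | nil => simp at h
    | cons q Q =>
      simp only [List.map_cons, List.cons.injEq] at h
      rcases hb : bump a r with ⟨r', _ | b⟩
      · have := bump_length hb
        simp only [Option.toList_none, List.length_nil] at this
        simp only [insertRecord, hb, List.headD_cons, List.tail_cons, List.map_cons, h.2,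
          List.length_append, List.length_singleton, h.1]
        rw [← this, add_zero]
      · have := bump_length hb
        simp only [Option.toList_some, List.length_singleton, Nat.add_right_cancel_iff] at this
        simp only [insertRecord, hb, List.headD_cons, List.tail_cons, List.map_cons, h.1, this,
          ih b Q h.2]

theorem insertRecord_snd_perm {n : ℕ} (k a : Fin n) (P Q : List (List (Fin n)))
    (h : Q.map List.length = P.map List.length) :
    (insertRecord k a P Q).2.flatten.Perm (k :: Q.flatten) := by
  induction P generalizing a Q with
  | nil =>
    cases Q with
    | nil => simp [insertRecord]
    | cons q Q => simp at h
  | cons r P ih =>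
    cases Q with
    | nil => simp at h
    | cons q Q =>
      simp only [List.map_cons, List.cons.injEq] at h
      rcases hb : bump a r with ⟨r', _ | b⟩
      · simp only [insertRecord, hb, List.headD_cons, List.tail_cons, List.flatten_cons]
        rw [List.append_assoc]
        exact List.perm_middle
      · simp only [insertRecord, hb, List.headD_cons, List.tail_cons, List.flatten_cons]
        exact ((ih b Q h.2).append_left q).trans List.perm_middle

theorem insertRecord_snd_sorted {n : ℕ} (k a : Fin n) (P Q : List (List (Fin n)))
    (hQ : ∀ r ∈ Q, r.Pairwise (· < ·)) (hk : ∀ b ∈ Q.flatten, b < k) :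
    ∀ r ∈ (insertRecord k a P Q).2, r.Pairwise (· < ·) := by
  induction P generalizing a Q with
  | nil => simp [insertRecord]
  | cons r P ih =>
    have h0 : (Q.headD []).Pairwise (· < ·) := by
      cases Q with
      | nil => simp
      | cons q Q => exact hQ q List.mem_cons_self
    have h1 : ∀ t ∈ Q.tail, t.Pairwise (· < ·) := fun t ht => hQ t (List.mem_of_mem_tail ht)
    have h2 : ∀ b ∈ Q.headD [], b < k := by
      cases Q with
      | nil => simp
      | cons q Q => exact fun b hb => hk b (by simp at hb; simp [hb])
    have h3 : ∀ b ∈ Q.tail.flatten, b < k := by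
      cases Q with
      | nil => simp
      | cons q Q => exact fun b hb => hk b (List.mem_append_right _ hb)
    rcases hb : bump a r with ⟨r', _ | b⟩
    · simp only [insertRecord, hb, List.mem_cons, forall_eq_or_imp]
      refine ⟨List.pairwise_append.mpr ⟨h0, by simp, fun b hb c hc => ?_⟩, h1⟩
      rw [List.mem_singleton.mp hc]
      exact h2 b hb
    · simp only [insertRecord, hb, List.mem_cons, forall_eq_or_imp]
      exact ⟨h0, ih b _ h1 h3⟩

theorem above_concat {n : ℕ} {k : Fin n} {u q : List (Fin n)} (h : Above u q)
    (hlen : q.length < u.length) (hk : ∀ b ∈ u, b < k) : Above u (q ++ [k]) := by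
  rw [above_iff] at *
  refine ⟨by simpa using hlen, fun j h1 h2 => ?_⟩
  rw [List.getElem_append]
  split_ifs with h3
  · exact h.2 j h1 h3
  · simpa using hk _ (List.getElem_mem h1)

theorem concat_above {n : ℕ} {k : Fin n} {q t : List (Fin n)} (h : Above q t) :
    Above (q ++ [k]) t := by
  rw [above_iff] at *
  refine ⟨by simp; omega, fun j h1 h2 => ?_⟩
  rw [List.getElem_append_left (by omega)]
  exact h.2 j (by omega) h2

theorem insertRecord_snd_chain_cons {n : ℕ} (k a : Fin n) (u v : List (Fin n))
    (P Q : List (List (Fin n))) (h : Q.map List.length = P.map List.length)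
    (huv : u.length = v.length) (hP : (v :: (insertRecord k a P Q).1).IsChain Above)
    (hQ : (u :: Q).IsChain Above) (hk : ∀ b ∈ (u :: Q).flatten, b < k) :
    (u :: (insertRecord k a P Q).2).IsChain Above := by
  induction P generalizing a u v Q with
  | nil =>
    simp only [insertRecord, List.isChain_cons_cons, List.isChain_singleton, and_true] at hP ⊢
    have hv := ((above_iff _ _).mp hP).1
    exact above_concat (q := []) (by simp [Above]) (by simp at hv ⊢; omega)
      fun b hb => hk b (List.mem_append_left _ hb)
  | cons r P ih =>
    cases Q with
    | nil => simp at h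
    | cons q Q =>
      simp only [List.map_cons, List.cons.injEq] at h
      rw [List.isChain_cons_cons] at hQ
      rcases hb : bump a r with ⟨r', _ | b⟩
      · have hl := bump_length hb
        simp only [insertRecord, hb, List.headD_cons, List.tail_cons,
          List.isChain_cons_cons] at hP ⊢
        have hv := ((above_iff _ _).mp hP.1).1
        simp only [Option.toList_none, List.length_nil] at hl
        refine ⟨above_concat hQ.1 (by omega) fun b hb => hk b (List.mem_append_left _ hb), ?_⟩
        cases Q with
        | nil => simp
        | cons t Q =>
          rw [List.isChain_cons_cons] at hQ ⊢
          exact ⟨concat_above hQ.2.1, hQ.2.2⟩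
      · have hl := bump_length hb
        simp only [insertRecord, hb, List.headD_cons, List.tail_cons,
          List.isChain_cons_cons] at hP ⊢
        simp only [Option.toList_some, List.length_singleton] at hl
        exact ⟨hQ.1, ih b q r' Q h.2 (by omega) hP.2 hQ.2
          fun b hb => hk b (List.mem_append_right _ hb)⟩

theorem insertRecord_snd_chain {n : ℕ} (k a : Fin n)
    (P Q : List (List (Fin n))) (h : Q.map List.length = P.map List.length)
    (hP : (insertRecord k a P Q).1.IsChain Above)
    (hQ : Q.IsChain Above) (hk : ∀ b ∈ Q.flatten, b < k) :
    (insertRecord k a P Q).2.IsChain Above := by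
  cases P with
  | nil => simp [insertRecord]
  | cons r P =>
    cases Q with
    | nil => simp at h
    | cons q Q =>
      simp only [List.map_cons, List.cons.injEq] at h
      rcases hb : bump a r with ⟨r', _ | b⟩
      · simp only [insertRecord, hb, List.headD_cons, List.tail_cons]
        cases Q with
        | nil => simp
        | cons t Q =>
          rw [List.isChain_cons_cons] at hQ ⊢
          exact ⟨concat_above hQ.1, hQ.2⟩
      · have hl := bump_length hb
        simp only [insertRecord, hb, List.headD_cons, List.tail_cons] at hP ⊢
        simp only [Option.toList_some, List.length_singleton] at hl
        exact insertRecord_snd_chain_cons k b q r' P Q h.2 (by omega) hP hQ hk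

theorem foldl_insertRecord {n : ℕ} (x : Equiv.Perm (Fin n)) (l : List (Fin n))
    (P Q : List (List (Fin n))) (hP : IsStandardRows P) (hQ : IsStandardRows Q)
    (h : Q.map List.length = P.map List.length) (hl : l.Pairwise (· < ·))
    (hk : ∀ b ∈ Q.flatten, ∀ k ∈ l, b < k) (hnd : (l.map x ++ P.flatten).Nodup) :
    let R := l.foldl (fun PQ k => insertRecord k (x k) PQ.1 PQ.2) (P, Q)
    IsStandardRows R.1 ∧ IsStandardRows R.2 ∧
      R.1.flatten.Perm (l.map x ++ P.flatten) ∧ R.2.flatten.Perm (l ++ Q.flatten) := by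
  induction l generalizing P Q with
  | nil => exact ⟨hP, hQ, List.Perm.refl _, List.Perm.refl _⟩
  | cons k l ih =>
    rw [List.pairwise_cons] at hl
    simp only [List.map_cons, List.cons_append] at hnd
    have hnd' : (x k :: P.flatten).Nodup :=
      hnd.sublist ((List.sublist_append_right _ _).cons_cons _)
    have p1 := insertRecord_perm k (x k) P Q
    have p2 := insertRecord_snd_perm k (x k) P Q h
    have c1 := insertRecord_chain k (x k) P Q hP
    have hk' : ∀ b ∈ Q.flatten, b < k := fun b hb => hk b hb k List.mem_cons_self
    have q1 : (l.map x ++ (insertRecord k (x k) P Q).1.flatten).Perm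
        (x k :: (l.map x ++ P.flatten)) :=
      (p1.append_left _).trans List.perm_middle
    have q2 : (l ++ (insertRecord k (x k) P Q).2.flatten).Perm (k :: (l ++ Q.flatten)) :=
      (p2.append_left _).trans List.perm_middle
    have := ih (insertRecord k (x k) P Q).1 (insertRecord k (x k) P Q).2
      ⟨c1, insertRecord_sorted k (x k) P Q hP.sorted hnd'⟩
      ⟨insertRecord_snd_chain k (x k) P Q h c1 hQ.chain hk',
        insertRecord_snd_sorted k (x k) P Q hQ.sorted hk'⟩
      (insertRecord_shape k (x k) P Q h) hl.2
      (fun b hb m hm => by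
        rcases List.mem_cons.mp (p2.subset hb) with rfl | hb
        · exact hl.1 m hm
        · exact hk b hb m (List.mem_cons_of_mem _ hm))
      (q1.nodup_iff.mpr hnd)
    exact ⟨this.1, this.2.1, this.2.2.1.trans q1, this.2.2.2.trans q2⟩

theorem rsRows_spec {n : ℕ} (x : Equiv.Perm (Fin n)) :
    IsStandardRows (rsRows x).1 ∧ IsStandardRows (rsRows x).2 ∧
      (rsRows x).1.flatten.Perm (List.finRange n) ∧
      (rsRows x).2.flatten.Perm (List.finRange n) := by
  have hnd : ((List.finRange n).map x).Nodup := (List.nodup_finRange n).map x.injective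
  have hs : (List.finRange n).Pairwise (· < ·) := List.pairwise_lt_finRange n
  have e : IsStandardRows (n := n) [] := ⟨by simp, by simp⟩
  obtain ⟨h1, h2, h3, h4⟩ := foldl_insertRecord x (List.finRange n) [] [] e e rfl hs (by simp)
    (by simpa using hnd)
  refine ⟨h1, h2, h3.trans ?_, h4.trans (by simp)⟩
  simp only [List.flatten_nil, List.append_nil]
  exact (List.perm_ext_iff_of_nodup hnd (List.nodup_finRange n)).mpr fun k => by
    simpa using x.surjective k

theorem IsStandardRows.above {n : ℕ} {L : List (List (Fin n))} (h : IsStandardRows L)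
    {i j : ℕ} (hi : i < L.length) (hj : j < L.length) (hij : i < j) : Above L[i] L[j] := by
  have : IsTrans (List (Fin n)) Above := ⟨fun _ _ _ => Above.trans⟩
  exact List.pairwise_iff_getElem.mp (List.isChain_iff_pairwise.mp h.chain) i j hi hj hij

theorem IsStandardRows.sortedGE {n : ℕ} {L : List (List (Fin n))} (h : IsStandardRows L) :
    (L.map List.length).SortedGE := by
  rw [List.sortedGE_iff_pairwise, List.pairwise_map, List.pairwise_iff_getElem]
  exact fun i j hi hj hij => ((above_iff _ _).mp (h.above hi hj hij)).1

/-- The Young diagram with row lengths those of `L`. -/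
def IsStandardRows.shape {n : ℕ} {L : List (List (Fin n))} (h : IsStandardRows L) :
    YoungDiagram := YoungDiagram.ofRowLens (L.map List.length) h.sortedGE

theorem IsStandardRows.mem_shape {n : ℕ} {L : List (List (Fin n))} (h : IsStandardRows L)
    {b : ℕ × ℕ} : b ∈ h.shape ↔ ∃ h : b.1 < L.length, b.2 < L[b.1].length := by
  simp [IsStandardRows.shape, YoungDiagram.mem_ofRowLens]

/-- The entry in the box `(r, c)` of the rows `L`. -/
def IsStandardRows.entry {n : ℕ} {L : List (List (Fin n))} (h : IsStandardRows L)
    (b : {b : ℕ × ℕ // b ∈ h.shape}) : Fin n :=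
  (L[b.1.1]'(h.mem_shape.mp b.2).1)[b.1.2]'(h.mem_shape.mp b.2).2

theorem IsStandardRows.entry_bijective {n : ℕ} {L : List (List (Fin n))} (h : IsStandardRows L)
    (hL : L.flatten.Perm (List.finRange n)) : Function.Bijective h.entry := by
  have hnd : L.flatten.Nodup := hL.nodup_iff.mpr (List.nodup_finRange n)
  rw [List.nodup_flatten] at hnd
  constructor
  · rintro ⟨⟨i, j⟩, hb⟩ ⟨⟨i', j'⟩, hb'⟩ he
    obtain ⟨h1, h2⟩ := h.mem_shape.mp hb
    obtain ⟨h1', h2'⟩ := h.mem_shape.mp hb'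
    simp only [IsStandardRows.entry] at he
    simp only at h1 h2 h1' h2'
    have hii : i = i' := by
      have hd := List.pairwise_iff_getElem.mp hnd.2
      rcases lt_trichotomy i i' with hlt | heq | hlt
      · exact absurd (he ▸ List.getElem_mem h2') (hd i i' h1 h1' hlt (List.getElem_mem h2))
      · exact heq
      · exact absurd (he ▸ List.getElem_mem h2) (hd i' i h1' h1 hlt (List.getElem_mem h2'))
    subst hii
    have hjj : j = j' :=
      ((hnd.1 _ (List.getElem_mem h1)).getElem_inj_iff).mp he
    subst hjj
    rfl
  · intro k
    have hk : k ∈ L.flatten := hL.mem_iff.mpr (List.mem_finRange k)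
    obtain ⟨r, hr, hkr⟩ := List.mem_flatten.mp hk
    obtain ⟨i, hi', rfl⟩ := List.getElem_of_mem hr
    obtain ⟨j, hj, rfl⟩ := List.getElem_of_mem hkr
    exact ⟨⟨(i, j), h.mem_shape.mpr ⟨hi', hj⟩⟩, rfl⟩

/-- The standard tableau with rows `L`. -/
noncomputable def StandardTableau.ofRows {n : ℕ} (L : List (List (Fin n)))
    (h : IsStandardRows L) (hL : L.flatten.Perm (List.finRange n)) : StandardTableau n where
  shape := h.shape
  label := Equiv.ofBijective h.entry (h.entry_bijective hL)
  row_strict := by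
    rintro ⟨⟨i, j⟩, hb⟩ ⟨⟨i', j'⟩, hb'⟩ (rfl : i = i') (hlt : j < j')
    exact List.pairwise_iff_getElem.mp (h.sorted _ (List.getElem_mem _)) j j' _ _ hlt
  col_strict := by
    rintro ⟨⟨i, j⟩, hb⟩ ⟨⟨i', j'⟩, hb'⟩ (rfl : j = j') (hlt : i < i')
    obtain ⟨h1, h2⟩ := h.mem_shape.mp hb
    obtain ⟨h1', h2'⟩ := h.mem_shape.mp hb'
    exact ((above_iff _ _).mp (h.above h1 h1' hlt)).2 j h2 h2'

/-- The insertion tableau `P(x)`. -/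
noncomputable def insertionTableau {n : ℕ} (x : Equiv.Perm (Fin n)) : StandardTableau n :=
  StandardTableau.ofRows (rsRows x).1 (rsRows_spec x).1 (rsRows_spec x).2.2.1

/-- The recording tableau `Q(x)`. -/
noncomputable def recordingTableau {n : ℕ} (x : Equiv.Perm (Fin n)) : StandardTableau n :=
  StandardTableau.ofRows (rsRows x).2 (rsRows_spec x).2.1 (rsRows_spec x).2.2.2

end RSTau

namespace RSTau

/-! ### The symmetry of the Robinson–Schensted correspondence -/

/-! The proof rests on three facts.

Symmetry: `P(x) = Q(x⁻¹)` (`insertionTableau_eq`). The algorithm is split by rows. The first row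
sees a list of pairs (time, letter) and passes on the list of pairs (time, bumped letter). For a
list and its inverse, the final row of the one is the list of extension times of the other, and the
lists passed on are inverse again (`IsInverseList.row`). So both claims reduce to statements about
`Q` and about tableaux.

Compatibility: `Q(x)` and `x⁻¹` have the same generalized invariant (`sameGenTau_recordingTableau`).
A standard tableau is encoded by its row word, which sends each label to the index of its row. The
invariant `τ` is the ascent set of this word, and `f_{i,j}` exchanges two neighbouring letters among
three consecutive ones, in a way that the word determines. On the side of `x⁻¹`, the map `f_{i,j}`
performs an elementary Knuth transformation on three consecutive entries of `x`. Such a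
transformation does not change the rows obtained by insertion (`insertRows_knuth_left`,
`insertRows_knuth_right`), and the rows in which the three insertions end are exchanged exactly as
in the tableau rule. Hence `f_{i,j}` commutes with passing to `Q`.

Completeness: a standard tableau is determined by its generalized invariant (`SameGenTau.eq`). Row
words of standard tableaux are ballot words, and ballot words of the same content are connected by
the exchanges above (`IsBallot.wordPath`). Suppose that two tableaux with the same invariant have
row words that first differ at label `m`, with letters `c < e + 1`. The ballot condition allows the
common prefix to be moved, in both tableaux at once, to a prefix ending in `e`. Then there is an
ascent into `m` in one tableau and not in the other, so the values of `τ` differ. -/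

theorem bump_append_of_forall_le {n : ℕ} {a : Fin n} {r : List (Fin n)} (t : List (Fin n))
    (h : ∀ c ∈ r, c ≤ a) : bump a (r ++ t) = (r ++ (bump a t).1, (bump a t).2) := by
  induction r with
  | nil => rfl
  | cons c r ih =>
    simp only [List.mem_cons, forall_eq_or_imp] at h
    simp [bump, h.1.not_gt, ih h.2]

theorem bump_eq_none {n : ℕ} {a : Fin n} {r : List (Fin n)} (h : (bump a r).2 = none) :
    (∀ c ∈ r, c ≤ a) ∧ (bump a r).1 = r ++ [a] := by
  induction r with
  | nil => simp [bump]
  | cons c r ih =>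
    by_cases hc : a < c
    · simp [bump, hc] at h
    · simp only [bump, hc, if_false] at h ⊢
      simp only [List.mem_cons, forall_eq_or_imp, List.cons_append]
      exact ⟨⟨not_lt.mp hc, (ih h).1⟩, by rw [(ih h).2]⟩

theorem bump_append_of_some {n : ℕ} {a b : Fin n} {r : List (Fin n)} (t : List (Fin n))
    (h : (bump a r).2 = some b) : bump a (r ++ t) = ((bump a r).1 ++ t, some b) := by
  induction r with
  | nil => simp [bump] at h
  | cons c r ih =>
    by_cases hc : a < c
    · simpa [bump, hc] using h
    · simp only [bump, hc, if_false] at h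
      simp [bump, hc, ih h]

/-- The row obtained from `R` by inserting the second components of the given pairs. -/
def finalRow {n : ℕ} : List (Fin n) → List (Fin n × Fin n) → List (Fin n)
  | R, [] => R
  | R, p :: L => finalRow (bump p.2 R).1 L

/-- The keys (first components) of the insertions into `R` that make the row longer. -/
def extKeys {n : ℕ} : List (Fin n) → List (Fin n × Fin n) → List (Fin n)
  | _, [] => []
  | R, p :: L => (if (bump p.2 R).2 = none then [p.1] else []) ++ extKeys (bump p.2 R).1 L

/-- The entries bumped out of the row `R`, together with the keys of the insertions that bump
them. -/
def bumped {n : ℕ} : List (Fin n) → List (Fin n × Fin n) → List (Fin n × Fin n)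
  | _, [] => []
  | R, p :: L => ((bump p.2 R).2.map (p.1, ·)).toList ++ bumped (bump p.2 R).1 L

theorem finalRow_append {n : ℕ} (R : List (Fin n)) (L M : List (Fin n × Fin n)) :
    finalRow R (L ++ M) = finalRow (finalRow R L) M := by
  induction L generalizing R with
  | nil => rfl
  | cons p L ih => simp [finalRow, ih]

theorem extKeys_append {n : ℕ} (R : List (Fin n)) (L M : List (Fin n × Fin n)) :
    extKeys R (L ++ M) = extKeys R L ++ extKeys (finalRow R L) M := by
  induction L generalizing R with
  | nil => rfl
  | cons p L ih => simp [finalRow, extKeys, ih]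

theorem bumped_append {n : ℕ} (R : List (Fin n)) (L M : List (Fin n × Fin n)) :
    bumped R (L ++ M) = bumped R L ++ bumped (finalRow R L) M := by
  induction L generalizing R with
  | nil => rfl
  | cons p L ih => simp [finalRow, bumped, ih]

theorem extKeys_sublist {n : ℕ} (R : List (Fin n)) (L : List (Fin n × Fin n)) :
    (extKeys R L).Sublist (L.map Prod.fst) := by
  induction L generalizing R with
  | nil => exact List.Sublist.refl _
  | cons p L ih =>
    simp only [extKeys, List.map_cons]
    split_ifs
    · exact (ih _).cons_cons _
    · exact (ih _).cons _

theorem bumped_sublist {n : ℕ} (R : List (Fin n)) (L : List (Fin n × Fin n)) :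
    ((bumped R L).map Prod.fst).Sublist (L.map Prod.fst) := by
  induction L generalizing R with
  | nil => exact List.Sublist.refl _
  | cons p L ih =>
    simp only [bumped, List.map_cons]
    rcases (bump p.2 R).2 with _ | b
    · exact (ih _).cons _
    · exact (ih _).cons_cons _

theorem mem_finalRow {n : ℕ} {R : List (Fin n)} {L : List (Fin n × Fin n)} {c : Fin n}
    (h : c ∈ finalRow R L) : c ∈ R ∨ c ∈ L.map Prod.snd := by
  induction L generalizing R with
  | nil => exact Or.inl h
  | cons p L ih =>
    simp only [List.map_cons, List.mem_cons]
    rcases ih h with h | h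
    · rcases mem_of_mem_bump h with h | h <;> simp [h]
    · simp [h]

/-- The effect of an additional largest entry at the end of the row: the first insertion that
would make the row longer bumps it. -/
theorem run_concat {n : ℕ} (k : Fin n) (R : List (Fin n)) (L : List (Fin n × Fin n))
    (hL : ∀ p ∈ L, p.2 < k) :
    (extKeys R L = [] → finalRow (R ++ [k]) L = finalRow R L ++ [k] ∧
      extKeys (R ++ [k]) L = [] ∧ bumped (R ++ [k]) L = bumped R L) ∧
    ∀ b E, extKeys R L = b :: E → finalRow (R ++ [k]) L = finalRow R L ∧
      extKeys (R ++ [k]) L = E ∧ (bumped (R ++ [k]) L).Perm ((b, k) :: bumped R L) := by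
  induction L generalizing R with
  | nil => simp [extKeys, finalRow, bumped]
  | cons p L ih =>
    simp only [List.mem_cons, forall_eq_or_imp] at hL
    -- An insertion that would extend `R` replaces `k` in `R ++ [k]` instead, since all inserted
    -- letters are smaller than `k`; from then on the two rows coincide. An insertion that bumps an
    -- entry of `R` does not see `k`.
    rcases hb : (bump p.2 R).2 with _ | c
    · obtain ⟨h1, h2⟩ := bump_eq_none hb
      have h3 := bump_append_of_forall_le [k] h1
      simp only [bump, hL.1, if_true] at h3
      simp only [extKeys, finalRow, bumped, hb, h3, ← h2]
      refine ⟨by simp, fun b E h => ?_⟩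
      simp only [if_true, List.singleton_append, List.cons.injEq] at h
      simp [h.1, h.2]
    · have h3 := bump_append_of_some [k] hb
      simp only [extKeys, finalRow, bumped, hb, h3]
      obtain ⟨i1, i2⟩ := ih (bump p.2 R).1 hL.2
      refine ⟨fun h => ?_, fun b E h => ?_⟩
      · have := i1 (by simpa using h)
        simp [this]
      · obtain ⟨j1, j2, j3⟩ := i2 b E (by simpa using h)
        refine ⟨j1, by simpa using j2, ?_⟩
        exact (j3.cons _).trans (List.Perm.swap _ _ _)

/-- Two lists of pairs, ordered by their first components, are inverse to each other if they
agree up to order and exchange of the components. -/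
def IsInverseList {n : ℕ} (L M : List (Fin n × Fin n)) : Prop :=
  L.Pairwise (fun p q => p.1 < q.1) ∧ M.Pairwise (fun p q => p.1 < q.1) ∧
    M.Perm (L.map Prod.swap)

/-- The induction removes the last pair `(k, a)` of `L`. In `M` this removes the pair `(a, k)` from
the middle, where `k` is the largest letter inserted: it is appended to the row and stays at its end
until the next extension would take place. In `L` the letter `a` is inserted last and bumps the
first entry larger than `a`. By induction the entries of that row are the extension times of `M`, so
the entry bumped by `a` is precisely the time at which `k` is bumped. -/
theorem IsInverseList.row {n : ℕ} {L M : List (Fin n × Fin n)} (h : IsInverseList L M) :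
    finalRow [] L = extKeys [] M ∧ extKeys [] L = finalRow [] M ∧
      (bumped [] M).Perm ((bumped [] L).map Prod.swap) := by
  induction L using List.reverseRecOn generalizing M with
  | nil =>
    have := h.2.2.eq_nil
    subst this
    simp [finalRow, extKeys, bumped]
  | append_singleton L p ih =>
    obtain ⟨k, a⟩ := p
    obtain ⟨h1, h2, h3⟩ := h
    have hm : (a, k) ∈ M := h3.mem_iff.mpr (by simp)
    obtain ⟨M1, M2, rfl⟩ := List.append_of_mem hm
    have hperm : (M1 ++ M2).Perm (L.map Prod.swap) := by
      have : ((a, k) :: (M1 ++ M2)).Perm ((a, k) :: L.map Prod.swap) :=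
        List.perm_middle.symm.trans (h3.trans (by simp))
      exact this.cons_inv
    rw [List.pairwise_append] at h1 h2
    obtain ⟨h2a, h2b, h2c⟩ := h2
    rw [List.pairwise_cons] at h2b
    have hM : (M1 ++ M2).Pairwise (fun p q => p.1 < q.1) :=
      List.pairwise_append.mpr ⟨h2a, h2b.2, fun p hp q hq => h2c p hp q (by simp [hq])⟩
    obtain ⟨i1, i2, i3⟩ := ih ⟨h1.1, hM, hperm⟩
    have hk : ∀ p ∈ M1 ++ M2, p.2 < k := fun p hp => by
      obtain ⟨q, hq, rfl⟩ := List.mem_map.mp (hperm.mem_iff.mp hp)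
      exact h1.2.2 q hq (k, a) (by simp)
    have hk1 : ∀ c ∈ finalRow [] M1, c < k := fun c hc => by
      rcases mem_finalRow hc with h | h
      · simp at h
      · obtain ⟨p, hp, rfl⟩ := List.mem_map.mp h
        exact hk p (by simp [hp])
    -- The final row of `L`, by induction a list of keys of `M`, splits at `a`: keys from `M1` lie
    -- below `a`, keys from `M2` above it.
    have hE1 : ∀ c ∈ extKeys [] M1, c ≤ a := fun c hc => by
      obtain ⟨p, hp, rfl⟩ := List.mem_map.mp ((extKeys_sublist _ _).subset hc)
      exact (h2c p hp (a, k) (by simp)).le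
    have hE2 : ∀ c ∈ extKeys (finalRow [] M1) M2, a < c := fun c hc => by
      obtain ⟨p, hp, rfl⟩ := List.mem_map.mp ((extKeys_sublist _ _).subset hc)
      exact h2b.1 p hp
    have hb : bump k (finalRow [] M1) = (finalRow [] M1 ++ [k], none) := by
      simpa [bump] using bump_append_of_forall_le [] fun c hc => (hk1 c hc).le
    obtain ⟨c1, c2⟩ := run_concat k (finalRow [] M1) M2 fun p hp => hk p (by simp [hp])
    rw [finalRow_append] at i2
    rw [extKeys_append] at i1
    rw [bumped_append] at i3
    simp only [finalRow_append, extKeys_append, bumped_append, finalRow, extKeys, bumped, hb, i1,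
      bump_append_of_forall_le _ hE1]
    -- Without an extension in `M2`, the letter `k` is never bumped and `a` extends the row of `L`.
    -- Otherwise the first extension time `b` is both the time at which `k` is bumped and the entry
    -- bumped by `a`.
    rcases he : extKeys (finalRow [] M1) M2 with _ | ⟨b, E⟩
    · obtain ⟨d1, d2, d3⟩ := c1 he
      simp only [d1, d2, d3, bump]
      simp only [if_true, List.append_nil, i2, Option.map_none, Option.toList_none, List.nil_append,
        true_and]
      exact i3
    · obtain ⟨d1, d2, d3⟩ := c2 b E he
      have hab : a < b := hE2 b (by simp [he])
      simp only [d1, d2, bump, hab, if_true, List.append_nil, Option.map_some, Option.toList_some,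
        reduceCtorEq, if_false, Option.map_none, Option.toList_none, List.nil_append,
        List.map_append, List.map_cons, List.map_nil, Prod.swap_prod_mk]
      refine ⟨by simp, i2, ?_⟩
      exact (d3.append_left _).trans (List.perm_middle.trans
        ((i3.cons _).trans (List.perm_append_singleton _ _).symm))

theorem IsInverseList.bumped {n : ℕ} {L M : List (Fin n × Fin n)} (h : IsInverseList L M) :
    IsInverseList (bumped [] L) (bumped [] M) := by
  refine ⟨?_, ?_, h.row.2.2⟩
  · exact List.pairwise_map.mp ((List.pairwise_map.mpr h.1).sublist (bumped_sublist [] L))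
  · exact List.pairwise_map.mp ((List.pairwise_map.mpr h.2.1).sublist (bumped_sublist [] M))

/-- The rows of the two tableaux obtained by inserting the second components of the given pairs,
and recording with the first components. -/
def pairRows {n : ℕ} (PQ : List (List (Fin n)) × List (List (Fin n)))
    (L : List (Fin n × Fin n)) : List (List (Fin n)) × List (List (Fin n)) :=
  L.foldl (fun PQ p => insertRecord p.1 p.2 PQ.1 PQ.2) PQ

/-- The lower rows are affected only by the bumped letters, so all insertions into the first row may
be carried out before those into the others. Keeping the original keys makes the recording labels
come out right. -/
theorem pairRows_cons {n : ℕ} (r q : List (Fin n)) (P Q : List (List (Fin n)))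
    (L : List (Fin n × Fin n)) : pairRows (r :: P, q :: Q) L =
      (finalRow r L :: (pairRows (P, Q) (bumped r L)).1,
        (q ++ extKeys r L) :: (pairRows (P, Q) (bumped r L)).2) := by
  induction L generalizing r q P Q with
  | nil => simp [pairRows, finalRow, extKeys, bumped]
  | cons p L ih =>
    rcases hb : bump p.2 r with ⟨r', _ | b⟩
    · have : pairRows (r :: P, q :: Q) (p :: L) = pairRows (r' :: P, (q ++ [p.1]) :: Q) L := by
        simp [pairRows, insertRecord, hb]
      rw [this, ih]
      simp [finalRow, extKeys, RSTau.bumped, hb]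
    · have : pairRows (r :: P, q :: Q) (p :: L) =
          pairRows (r' :: (insertRecord p.1 b P Q).1, q :: (insertRecord p.1 b P Q).2) L := by
        simp [pairRows, insertRecord, hb]
      rw [this, ih]
      simp [finalRow, extKeys, RSTau.bumped, hb, pairRows]

theorem pairRows_nil {n : ℕ} (p : Fin n × Fin n) (L : List (Fin n × Fin n)) :
    pairRows ([], []) (p :: L) =
      (finalRow [] (p :: L) :: (pairRows ([], []) (RSTau.bumped [] (p :: L))).1,
        extKeys [] (p :: L) :: (pairRows ([], []) (RSTau.bumped [] (p :: L))).2) := by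
  have : pairRows ([], []) (p :: L) = pairRows ([[p.2]], [[p.1]]) L := by
    simp [pairRows, insertRecord]
  rw [this, pairRows_cons]
  simp [finalRow, extKeys, RSTau.bumped, bump]

theorem length_bumped_le {n : ℕ} (R : List (Fin n)) (L : List (Fin n × Fin n)) :
    (RSTau.bumped R L).length ≤ L.length := by
  simpa using (bumped_sublist R L).length_le

/-- `IsInverseList.row` compares the first rows, and the bumped lists are again inverse to each
other, which gives the lower rows by induction on length. -/
theorem IsInverseList.pairRows {n : ℕ} {L M : List (Fin n × Fin n)} (h : IsInverseList L M) :
    (pairRows ([], []) L).1 = (pairRows ([], []) M).2 := by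
  induction hl : L.length using Nat.strong_induction_on generalizing L M with
  | _ m ih =>
    rcases L with _ | ⟨p, L⟩
    · have := h.2.2.eq_nil
      subst this
      rfl
    · rcases M with _ | ⟨q, M⟩
      · simpa using h.2.2.length_eq
      -- The first insertion goes into an empty row and bumps nothing, so the list becomes strictly
      -- shorter.
      · have hlt : (RSTau.bumped [] (p :: L)).length < m := by
          have := length_bumped_le [p.2] L
          rw [← hl]
          simpa [RSTau.bumped, bump, Nat.lt_succ_iff] using this
        rw [pairRows_nil, pairRows_nil, ih _ hlt h.bumped rfl, h.row.1]

theorem rsRows_eq_pairRows {n : ℕ} (x : Equiv.Perm (Fin n)) :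
    rsRows x = pairRows ([], []) ((List.finRange n).map fun k => (k, x k)) := by
  simp [rsRows, pairRows, List.foldl_map]

theorem isInverseList_inv {n : ℕ} (x : Equiv.Perm (Fin n)) :
    IsInverseList ((List.finRange n).map fun k => (k, x k))
      ((List.finRange n).map fun k => (k, x⁻¹ k)) := by
  refine ⟨List.pairwise_map.mpr (List.pairwise_lt_finRange n),
    List.pairwise_map.mpr (List.pairwise_lt_finRange n), ?_⟩
  have hp : (List.finRange n).Perm ((List.finRange n).map x) :=
    (List.perm_ext_iff_of_nodup (List.nodup_finRange n)
      ((List.nodup_finRange n).map x.injective)).mpr fun k => by simpa using x.surjective k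
  refine (hp.map _).trans ?_
  simp [List.map_map, Function.comp_def]

theorem insertionTableau_eq {n : ℕ} (x : Equiv.Perm (Fin n)) :
    insertionTableau x = recordingTableau x⁻¹ := by
  have h : (rsRows x).1 = (rsRows x⁻¹).2 := by
    rw [rsRows_eq_pairRows, rsRows_eq_pairRows]
    exact (isInverseList_inv x).pairRows
  simp only [insertionTableau, recordingTableau, h]

/-! ### Row insertion of two and of three letters -/

/-- The larger letter passes the place where `a` was put, hence acts strictly to its right. -/
theorem bump_bump_of_lt {n : ℕ} {a b : Fin n} (hab : a < b) {R : List (Fin n)}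
    (hR : R.Pairwise (· < ·)) :
    ((bump a R).2 = none → (bump b (bump a R).1).2 = none) ∧
      ∀ a' b', (bump a R).2 = some a' → (bump b (bump a R).1).2 = some b' → a' < b' := by
  induction R with
  | nil => simp [bump, hab.not_gt]
  | cons c R ih =>
    rw [List.pairwise_cons] at hR
    by_cases hc : a < c
    · simp only [bump, hc, if_true, hab.not_gt, if_false, reduceCtorEq, Option.some.injEq,
        false_imp_iff, true_and]
      rintro _ b' rfl hb
      exact hR.1 _ (mem_of_bump_eq (Prod.ext rfl hb)).1
    · have hc' : ¬ b < c := fun h => hc (hab.trans h)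
      simpa only [bump, hc, hc', if_false] using ih hR.2

/-- After its insertion `a` is an entry larger than `b`, and all entries to its left are at most
`a`; the leftmost entry larger than `b` is among these. -/
theorem bump_bump_of_gt {n : ℕ} {a b : Fin n} (hba : b < a) (R : List (Fin n)) :
    ∃ b', (bump b (bump a R).1).2 = some b' ∧ b' ≤ a := by
  induction R with
  | nil => simp [bump, hba]
  | cons c R ih =>
    by_cases hc : a < c
    · simp [bump, hc, hba]
    · by_cases hb : b < c
      · simp only [bump, hc, hb, if_true, if_false, Option.some.injEq, exists_eq_left']
        exact not_lt.mp hc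
      · simpa only [bump, hc, hb, if_false] using ih

/-- Once `y` is in the row, `x` acts at the place of `y` or to its left and `z` strictly to its
right, so the two insertions do not interact. -/
theorem bump_knuth_left {n : ℕ} {x y z : Fin n} (hxy : x < y) (hyz : y < z) (R : List (Fin n)) :
    (bump x (bump z (bump y R).1).1).1 = (bump z (bump x (bump y R).1).1).1 ∧
      (bump x (bump z (bump y R).1).1).2 = (bump x (bump y R).1).2 ∧
      (bump z (bump x (bump y R).1).1).2 = (bump z (bump y R).1).2 := by
  induction R with
  | nil => simp [bump, hxy, hyz.not_gt, (hxy.trans hyz).not_gt]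
  | cons c R ih =>
    by_cases h1 : y < c
    · simp [bump, h1, hyz.not_gt, hxy, (hxy.trans hyz).not_gt]
    · have h2 : ¬ z < c := fun h => h1 (hyz.trans h)
      by_cases h3 : x < c
      · simp [bump, h1, h2, h3, (hxy.trans hyz).not_gt]
      · simpa [bump, h1, h2, h3] using ih

/-- In the first alternative `x` and `z` act at different places, and the bumped letters form the
same pattern again, with `x' < y' ≤ z`. In the second they compete for the same place; then `z`
itself is bumped, by `y` in one order and by `x` in the other, and the pattern passed to the next
row is that of `bump_knuth_left`. -/
theorem bump_knuth_right {n : ℕ} {x y z : Fin n} (hxy : x < y) (hyz : y < z) {R : List (Fin n)}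
    (hR : R.Pairwise (· < ·)) (hz : z ∉ R) :
    (bump y (bump z (bump x R).1).1).1 = (bump y (bump x (bump z R).1).1).1 ∧
      ((∃ x' y', (bump x R).2 = some x' ∧ (bump x (bump z R).1).2 = some x' ∧
          (bump y (bump z (bump x R).1).1).2 = some y' ∧
          (bump y (bump x (bump z R).1).1).2 = some y' ∧
          (bump z (bump x R).1).2 = (bump z R).2 ∧ x' < y' ∧ y' ≤ z) ∨
        ((bump x R).2 = (bump z R).2 ∧
          (bump z (bump x R).1).2 = (bump y (bump x (bump z R).1).1).2 ∧
          (bump y (bump z (bump x R).1).1).2 = some z ∧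
          (bump x (bump z R).1).2 = some z)) := by
  have hxz := hxy.trans hyz
  induction R with
  | nil => simp [bump, hxy.not_gt, hxz.not_gt, hxz, hyz]
  | cons c R ih =>
    rw [List.pairwise_cons] at hR
    rw [List.mem_cons, not_or] at hz
    -- If the first entry `c` exceeds `z`, both `x` and `z` aim at it. If it lies between `x` and
    -- `z`, then `x` takes it and `z` acts further right. If it is below both, it plays no role.
    rcases lt_or_gt_of_ne hz.1 with h1 | h1
    · have h2 : x < c := hxz.trans h1
      have h3 : y < c := hyz.trans h1
      rcases R with _ | ⟨d, R⟩
      · simp [bump, h1, h2, hxy.not_gt, hxz.not_gt, hxz, hyz]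
      · have hd : c < d := hR.1 d (by simp)
        simp [bump, h1, h2, hxy.not_gt, hxz.not_gt, hxz, hyz, h1.trans hd, h3.trans hd]
    · have h1' := h1.not_gt
      by_cases h2 : x < c
      · obtain ⟨y', h3, h4⟩ := bump_bump_of_gt hyz R
        have h5 : c < y' := by
          rcases mem_of_mem_bump (mem_of_bump_eq (Prod.ext rfl h3)).1 with h | h
          · exact h ▸ h1
          · exact hR.1 _ h
        simp [bump, h1', h2, hxy.not_gt, hxz.not_gt, h3, h4, h5]
      · have h3 : ¬ y < c := fun h => h2 (hxy.trans h)
        simpa [bump, h1', h2, h3] using ih hR.2 hz.2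

/-- The rows after inserting `a` into the rows `P`. -/
def insertRows {n : ℕ} (a : Fin n) : List (List (Fin n)) → List (List (Fin n))
  | [] => [[a]]
  | r :: P => (bump a r).1 :: ((bump a r).2.elim P fun b => insertRows b P)

/-- The index of the row that becomes longer when `a` is inserted into the rows `P`. -/
def insertIndex {n : ℕ} (a : Fin n) : List (List (Fin n)) → ℕ
  | [] => 0
  | r :: P => (bump a r).2.elim 0 fun b => insertIndex b P + 1

theorem insertRecord_fst {n : ℕ} (k a : Fin n) (P Q : List (List (Fin n))) :
    (insertRecord k a P Q).1 = insertRows a P := by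
  induction P generalizing a Q with
  | nil => rfl
  | cons r P ih => rcases hb : bump a r with ⟨r', _ | b⟩ <;> simp [insertRecord, insertRows, hb, ih]

/-- The inequality `a < b` is inherited by the bumped letters, and in each row the insertion of the
larger one stops if that of the smaller one does. -/
theorem insertIndex_le_of_lt {n : ℕ} {a b : Fin n} (hab : a < b) {P : List (List (Fin n))}
    (hP : ∀ r ∈ P, r.Pairwise (· < ·)) :
    insertIndex b (insertRows a P) ≤ insertIndex a P := by
  induction P generalizing a b with
  | nil => simp [insertIndex, insertRows, bump, hab.not_gt]
  | cons r P ih =>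
    simp only [List.mem_cons, forall_eq_or_imp] at hP
    obtain ⟨h1, h2⟩ := bump_bump_of_lt hab hP.1
    rcases ha : (bump a r).2 with _ | a'
    · simp [insertIndex, insertRows, ha, h1 ha]
    · rcases hb : (bump b (bump a r).1).2 with _ | b'
      · simp [insertIndex, insertRows, ha, hb]
      · simpa [insertIndex, insertRows, ha, hb] using ih (h2 a' b' ha hb) hP.2

/-- In each row the second letter bumps something at most the first letter, hence smaller than what
the first letter bumped. So the second insertion continues at least one row further. -/
theorem insertIndex_lt_of_gt {n : ℕ} {a b : Fin n} (hba : b < a) (P : List (List (Fin n))) :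
    insertIndex a P < insertIndex b (insertRows a P) := by
  induction P generalizing a b with
  | nil => simp [insertIndex, insertRows, bump, hba]
  | cons r P ih =>
    obtain ⟨b', h1, h2⟩ := bump_bump_of_gt hba r
    rcases ha : (bump a r).2 with _ | a'
    · simp [insertIndex, insertRows, ha, h1]
    · have := ih (h2.trans_lt (mem_of_bump_eq (Prod.ext rfl ha)).2)
      simpa [insertIndex, insertRows, ha, h1] using this

/-- The bumped letters again satisfy `x' < y' < z'`, so the pattern is reproduced from row to row
until one of the insertions stops. For the recording tableau, the last two of three row indices are
exchanged. -/
theorem insertRows_knuth_left {n : ℕ} {x y z : Fin n} (hxy : x < y) (hyz : y < z)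
    {P : List (List (Fin n))} (hP : ∀ r ∈ P, r.Pairwise (· < ·)) :
    insertRows x (insertRows z (insertRows y P)) = insertRows z (insertRows x (insertRows y P)) ∧
      insertIndex z (insertRows x (insertRows y P)) = insertIndex z (insertRows y P) ∧
      insertIndex x (insertRows z (insertRows y P)) = insertIndex x (insertRows y P) := by
  induction P generalizing x y z with
  | nil => simp [insertRows, insertIndex, bump, hxy, hyz.not_gt, (hxy.trans hyz).not_gt]
  | cons r P ih =>
    simp only [List.mem_cons, forall_eq_or_imp] at hP
    obtain ⟨h1, h2, h3⟩ := bump_knuth_left hxy hyz r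
    obtain ⟨x', h4, h5⟩ := bump_bump_of_gt hxy r
    obtain ⟨h6, h7⟩ := bump_bump_of_lt hyz hP.1
    rcases hy : (bump y r).2 with _ | y'
    · simp [insertRows, insertIndex, h1, h2, h3, h4, hy, h6 hy]
    · rcases hz : (bump z (bump y r).1).2 with _ | z'
      · simp [insertRows, insertIndex, h1, h2, h3, h4, hy, hz]
      · have := ih (h5.trans_lt (mem_of_bump_eq (Prod.ext rfl hy)).2) (h7 y' z' hy hz) hP.2
        simpa [insertRows, insertIndex, h1, h2, h3, h4, hy, hz] using this

/-- The two alternatives say that the first two, respectively the last two, of three row indices are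
exchanged. The inequality in the first one supplies the condition `r ≤ q` of `TripleMove`; in the
second that condition follows from `insertIndex_lt_of_gt`. -/
theorem insertRows_knuth_right {n : ℕ} {x y z : Fin n} (hxy : x < y) (hyz : y < z)
    {P : List (List (Fin n))} (hP : ∀ r ∈ P, r.Pairwise (· < ·)) (hnd : (z :: P.flatten).Nodup) :
    insertRows y (insertRows z (insertRows x P)) = insertRows y (insertRows x (insertRows z P)) ∧
      ((insertIndex z P = insertIndex z (insertRows x P) ∧
          insertIndex x (insertRows z P) = insertIndex x P ∧
          insertIndex y (insertRows x (insertRows z P)) =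
            insertIndex y (insertRows z (insertRows x P)) ∧
          insertIndex y (insertRows z (insertRows x P)) ≤ insertIndex x P) ∨
        (insertIndex z P = insertIndex x P ∧
          insertIndex x (insertRows z P) = insertIndex y (insertRows z (insertRows x P)) ∧
          insertIndex y (insertRows x (insertRows z P)) = insertIndex z (insertRows x P))) := by
  have hxz := hxy.trans hyz
  induction P generalizing x y z with
  | nil => simp [insertRows, insertIndex, bump, hxy.not_gt, hyz, hxz, hxz.not_gt]
  | cons r P ih =>
    simp only [List.mem_cons, forall_eq_or_imp] at hP
    simp only [List.flatten_cons, List.nodup_cons, List.mem_append, not_or, List.nodup_append]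
      at hnd
    obtain ⟨⟨hz1, hz2⟩, hn1, hn2, hn3⟩ := hnd
    obtain ⟨h1, h2⟩ := bump_knuth_right hxy hyz hP.1 hz1
    rcases h2 with ⟨x', y', e1, e2, e3, e4, e5, e6, e7⟩ | ⟨e1, e2, e3, e4⟩
    · rcases hz : (bump z r).2 with _ | z'
      · have := insertIndex_le_of_lt e6 hP.2
        simp [insertRows, insertIndex, h1, e1, e2, e3, e4, e5, hz, this]
      · have hz' := mem_of_bump_eq (Prod.ext rfl hz)
        have := ih e6 (e7.trans_lt hz'.2) hP.2
          (List.nodup_cons.mpr ⟨fun h => hn3 _ hz'.1 _ h rfl, hn2⟩) (e6.trans (e7.trans_lt hz'.2))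
        simpa [insertRows, insertIndex, h1, e1, e2, e3, e4, e5, hz] using this
    · obtain ⟨h6, h7⟩ := bump_bump_of_lt hxz hP.1
      rcases hx : (bump x r).2 with _ | x'
      · have hz := h6 hx
        simp [insertRows, insertIndex, h1, ← e1, ← e2, e3, e4, hx, hz]
      · have hzx : z < x' := (mem_of_bump_eq (Prod.ext rfl (e1 ▸ hx))).2
        rcases hz : (bump z (bump x r).1).2 with _ | z'
        · simp [insertRows, insertIndex, h1, ← e1, ← e2, e3, e4, hx, hz]
        -- The letters passed on are `x', z', z` in one order and `x', z, z'` in the other, with `z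
        -- < x' < z'`: the left pattern with `x'` in the middle.
        · have := insertRows_knuth_left hzx (h7 x' z' hx hz) hP.2
          simp [insertRows, insertIndex, h1, ← e1, ← e2, e3, e4, hx, hz, this]

/-! ### The rows of the recording tableau -/

theorem insertRows_flatten_perm {n : ℕ} (a : Fin n) (P : List (List (Fin n))) :
    (insertRows a P).flatten.Perm (a :: P.flatten) := by
  rw [← insertRecord_fst a a P []]
  exact insertRecord_perm a a P []

theorem insertRows_sorted {n : ℕ} {a : Fin n} {P : List (List (Fin n))}
    (hP : ∀ r ∈ P, r.Pairwise (· < ·)) (hnd : (a :: P.flatten).Nodup) :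
    ∀ r ∈ insertRows a P, r.Pairwise (· < ·) := by
  rw [← insertRecord_fst a a P []]
  exact insertRecord_sorted a a P [] hP hnd

/-- The rows obtained by inserting the first `m` entries of the one-line notation of `x`. -/
def prefixRows {n : ℕ} (x : Equiv.Perm (Fin n)) : ℕ → List (List (Fin n))
  | 0 => []
  | m + 1 => if h : m < n then insertRows (x ⟨m, h⟩) (prefixRows x m) else prefixRows x m

theorem prefixRows_succ {n : ℕ} (x : Equiv.Perm (Fin n)) (k : Fin n) :
    prefixRows x (k + 1) = insertRows (x k) (prefixRows x k) := by
  simp [prefixRows]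

theorem prefixRows_spec {n : ℕ} (x : Equiv.Perm (Fin n)) (m : ℕ) (hm : m ≤ n) :
    (∀ r ∈ prefixRows x m, r.Pairwise (· < ·)) ∧ (prefixRows x m).flatten.Nodup ∧
      ∀ k : Fin n, m ≤ k → x k ∉ (prefixRows x m).flatten := by
  induction m with
  | zero => simp [prefixRows]
  | succ m ih =>
    obtain ⟨h1, h2, h3⟩ := ih (by omega)
    have hp := insertRows_flatten_perm (x ⟨m, hm⟩) (prefixRows x m)
    have hnd : (x ⟨m, hm⟩ :: (prefixRows x m).flatten).Nodup :=
      List.nodup_cons.mpr ⟨h3 ⟨m, hm⟩ le_rfl, h2⟩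
    rw [show prefixRows x (m + 1) = _ from prefixRows_succ x ⟨m, hm⟩]
    refine ⟨insertRows_sorted h1 hnd, hp.nodup_iff.mpr hnd, fun k hk h => ?_⟩
    rcases List.mem_cons.mp (hp.mem_iff.mp h) with h | h
    · have := congrArg Fin.val (x.injective h)
      simp at this
      omega
    · exact h3 k (by omega) h

/-- It serves both before a modified window of positions (with `m = 0`) and after it, where equality
of the rows at the end of the window propagates. -/
theorem prefixRows_congr {n : ℕ} {x y : Equiv.Perm (Fin n)} {m m' : ℕ} (hm : m ≤ m')
    (h : prefixRows x m = prefixRows y m) (hxy : ∀ k : Fin n, m ≤ k → k < m' → x k = y k) :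
    prefixRows x m' = prefixRows y m' := by
  induction m', hm using Nat.le_induction with
  | base => exact h
  | succ l hl ih =>
    have := ih fun k h1 h2 => hxy k h1 (by omega)
    simp only [prefixRows, this]
    split_ifs with hln
    · rw [hxy ⟨l, hln⟩ hl (Nat.lt_succ_self l)]
    · rfl

/-- The default `[]` treats a row not yet present as empty, so the opening of a new row needs no
separate statement. -/
theorem mem_insertRecord_snd {n : ℕ} (k a : Fin n) (P Q : List (List (Fin n)))
    (h : Q.map List.length = P.map List.length) :
    k ∈ (insertRecord k a P Q).2.getD (insertIndex a P) [] ∧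
      ∀ b r, b ∈ Q.getD r [] → b ∈ (insertRecord k a P Q).2.getD r [] := by
  induction P generalizing a Q with
  | nil =>
    have : Q = [] := by simpa using h
    simp [this, insertRecord, insertIndex]
  | cons p P ih =>
    rcases Q with _ | ⟨q, Q⟩
    · simp at h
    · simp only [List.map_cons, List.cons.injEq] at h
      rcases hb : bump a p with ⟨p', _ | b⟩
      · simp only [insertRecord, insertIndex, hb, Option.elim_none, List.headD_cons,
          List.tail_cons, List.getD_cons_zero, List.mem_append, List.mem_singleton, or_true,
          true_and]
        rintro c (_ | r) hc
        · simpa using Or.inl hc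
        · simpa using hc
      · obtain ⟨h1, h2⟩ := ih b Q h.2
        simp only [insertRecord, insertIndex, hb, Option.elim_some, List.headD_cons,
          List.tail_cons, List.getD_cons_succ]
        refine ⟨h1, ?_⟩
        rintro c (_ | r) hc
        · simpa using hc
        · simpa using h2 c r (by simpa using hc)

theorem foldl_take_insertRecord {n : ℕ} (x : Equiv.Perm (Fin n)) (m : ℕ) (hm : m ≤ n) :
    let R := ((List.finRange n).take m).foldl
      (fun PQ k => insertRecord k (x k) PQ.1 PQ.2) ([], [])
    R.1 = prefixRows x m ∧ R.2.map List.length = R.1.map List.length ∧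
      ∀ k : Fin n, k < m → k ∈ R.2.getD (insertIndex (x k) (prefixRows x k)) [] := by
  induction m with
  | zero => simp [prefixRows]
  | succ m ih =>
    have hl : m < (List.finRange n).length := by simpa using hm
    have ht : (List.finRange n).take (m + 1) = (List.finRange n).take m ++ [⟨m, hm⟩] := by
      rw [List.take_succ_eq_append_getElem hl]
      simp
    simp only [ht, List.foldl_append, List.foldl_cons, List.foldl_nil]
    obtain ⟨h1, h2, h3⟩ := ih (by omega)
    obtain ⟨h4, h5⟩ := mem_insertRecord_snd ⟨m, hm⟩ (x ⟨m, hm⟩) _ _ h2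
    refine ⟨?_, insertRecord_shape _ _ _ _ h2, fun k hk => ?_⟩
    · rw [insertRecord_fst, h1]
      exact (prefixRows_succ x ⟨m, hm⟩).symm
    · rcases Nat.lt_succ_iff_lt_or_eq.mp hk with hk | hk
      · exact h5 _ _ (h3 k hk)
      · have : k = ⟨m, hm⟩ := Fin.ext hk
        subst this
        rwa [h1] at h4 ⊢

theorem StandardTableau.box_ofRows {n : ℕ} {L : List (List (Fin n))} (h : IsStandardRows L)
    (hL : L.flatten.Perm (List.finRange n)) {k : Fin n} {r : ℕ} (hk : k ∈ L.getD r []) :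
    ((StandardTableau.ofRows L h hL).box k).1 = r := by
  have hr : r < L.length := by
    by_contra hr
    rw [List.getD_eq_default _ _ (not_lt.mp hr)] at hk
    simp at hk
  rw [List.getD_eq_getElem _ _ hr] at hk
  obtain ⟨c, hc, rfl⟩ := List.getElem_of_mem hk
  exact congrArg Prod.fst ((StandardTableau.ofRows L h hL).box_label
    ⟨(r, c), h.mem_shape.mpr ⟨hr, hc⟩⟩)

theorem box_recordingTableau {n : ℕ} (x : Equiv.Perm (Fin n)) (k : Fin n) :
    ((recordingTableau x).box k).1 = insertIndex (x k) (prefixRows x k) := by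
  refine StandardTableau.box_ofRows _ _ ?_
  have := (foldl_take_insertRecord x n le_rfl).2.2 k k.2
  rwa [List.take_of_length_le (by simp)] at this

/-! ### Row words -/

/-- The index of the row containing the letter `k` (counted from `0`). -/
def StandardTableau.row {n : ℕ} (Y : StandardTableau n) (k : ℕ) : ℕ :=
  if h : k < n then (Y.box ⟨k, h⟩).1 else 0

theorem StandardTableau.row_coe {n : ℕ} (Y : StandardTableau n) (k : Fin n) :
    Y.row k = (Y.box k).1 := by
  simp [StandardTableau.row]

theorem StandardTableau.row_lo {n : ℕ} (Y : StandardTableau n) (i : Fin (n - 1)) :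
    Y.row i = (Y.box (lo i)).1 := Y.row_coe (lo i)

theorem StandardTableau.row_hi {n : ℕ} (Y : StandardTableau n) (i : Fin (n - 1)) :
    Y.row (i + 1) = (Y.box (hi i)).1 := Y.row_coe (hi i)

theorem mem_tableauTau {n : ℕ} {i : Fin (n - 1)} {Y : StandardTableau n} :
    i ∈ tableauTau Y ↔ Y.row i < Y.row (i + 1) := by
  rw [Y.row_lo, Y.row_hi]
  rfl

/-- An exchange of two adjacent letters of a three-letter word, from a word whose unique ascent
is the first one to a word whose unique ascent is the second one. -/
def TripleMove (p q r p' q' r' : ℕ) : Prop :=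
  (p < q ∧ r ≤ q) ∧ (q' ≤ p' ∧ q' < r') ∧
    ((p' = q ∧ q' = p ∧ r' = r) ∨ (p' = p ∧ q' = r ∧ r' = q))

/-- The words `ρ` and `σ` differ by a `TripleMove` of the letters `k`, `k + 1`, `k + 2`. -/
def RowMove (k : ℕ) (ρ σ : ℕ → ℕ) : Prop :=
  TripleMove (ρ k) (ρ (k + 1)) (ρ (k + 2)) (σ k) (σ (k + 1)) (σ (k + 2)) ∧
    ∀ m, m < k ∨ k + 3 ≤ m → σ m = ρ m

theorem eq_of_window {k : ℕ} {ρ σ : ℕ → ℕ} (h0 : ρ k = σ k) (h1 : ρ (k + 1) = σ (k + 1))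
    (h2 : ρ (k + 2) = σ (k + 2)) (h : ∀ m, m < k ∨ k + 3 ≤ m → ρ m = σ m) : ρ = σ := by
  funext m
  by_cases hm : m < k ∨ k + 3 ≤ m
  · exact h m hm
  · obtain rfl | rfl | rfl : m = k ∨ m = k + 1 ∨ m = k + 2 := by omega
    exacts [h0, h1, h2]

/-- The two exchanges exclude each other: the required position of the ascent forces `p < r` for the
first and `r ≤ p` for the second. -/
theorem RowMove.right_unique {k : ℕ} {ρ σ σ' : ℕ → ℕ} (h : RowMove k ρ σ) (h' : RowMove k ρ σ') :
    σ = σ' := by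
  obtain ⟨⟨a, b, c⟩, d⟩ := h
  obtain ⟨⟨a', b', c'⟩, d'⟩ := h'
  refine eq_of_window (k := k) ?_ ?_ ?_ fun m hm => (d m hm).trans (d' m hm).symm <;> omega

/-- Here the comparison of `r'` with `p'` decides which exchange took place. -/
theorem RowMove.left_unique {k : ℕ} {ρ σ σ' : ℕ → ℕ} (h : RowMove k σ ρ) (h' : RowMove k σ' ρ) :
    σ = σ' := by
  obtain ⟨⟨a, b, c⟩, d⟩ := h
  obtain ⟨⟨a', b', c'⟩, d'⟩ := h'
  refine eq_of_window (k := k) ?_ ?_ ?_ fun m hm => (d m hm).symm.trans (d' m hm) <;> omega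

/-! ### The maps `f_{i,j}` in terms of row words. -/

theorem row_eq_of_relabel {n : ℕ} {Y Z : StandardTableau n} {i : Fin (n - 1)}
    (h : Z.toTableau = Y.relabel (s i)) : Z.row i = Y.row (i + 1) ∧ Z.row (i + 1) = Y.row i ∧
      ∀ m : ℕ, m ≠ i → m ≠ i + 1 → Z.row m = Y.row m := by
  simp only [StandardTableau.row_lo, StandardTableau.row_hi, box_lo_of_eq h, box_hi_of_eq h,
    true_and]
  intro m h1 h2
  by_cases hm : m < n
  · have := box_of_ne_of_eq h (k := ⟨m, hm⟩) (by simpa [lo, Fin.ext_iff] using h1)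
      (by simpa [hi, Fin.ext_iff] using h2)
    simp [StandardTableau.row, hm, this]
  · simp [StandardTableau.row, hm]

theorem rowMove_of_relabel {n : ℕ} {Y Z : StandardTableau n} {i j : Fin (n - 1)}
    (hij : i.1 + 1 = j.1) (hY : Y ∈ D tableauTau i j) (hZ : Z ∈ D tableauTau j i)
    (h : Z.toTableau = Y.relabel (s i) ∨ Z.toTableau = Y.relabel (s j)) :
    RowMove i Y.row Z.row := by
  simp only [D, Set.mem_ofPred_eq, mem_tableauTau, ← hij, not_lt] at hY hZ
  rw [add_assoc] at hY hZ
  rcases h with h | h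
  · obtain ⟨h1, h2, h3⟩ := row_eq_of_relabel h
    have h4 := h3 (i + 2) (by omega) (by omega)
    exact ⟨⟨hY, hZ.symm, Or.inl ⟨h1, h2, h4⟩⟩, fun m hm => h3 m (by omega) (by omega)⟩
  · obtain ⟨h1, h2, h3⟩ := row_eq_of_relabel h
    rw [← hij] at h1 h2 h3
    have h4 := h3 i (by omega) (by omega)
    exact ⟨⟨hY, hZ.symm, Or.inr ⟨h4, h1, h2⟩⟩, fun m hm => h3 m (by omega) (by omega)⟩

theorem relabel_symm {n : ℕ} {Y Z : StandardTableau n} {i : Fin (n - 1)}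
    (h : Z.toTableau = Y.relabel (s i)) : Y.toTableau = Z.relabel (s i) := by
  rw [h]
  have : (s i).trans (s i) = Equiv.refl _ := Equiv.ext fun k => by simp [s]
  simp [Tableau.relabel, Equiv.trans_assoc, this]

/-- Two row words are related as those of `Y` and `f_{i,j}(Y)` are. -/
def RowRel {n : ℕ} (i j : Fin (n - 1)) (ρ σ : ℕ → ℕ) : Prop :=
  (i.1 + 1 = j.1 ∧ RowMove i ρ σ) ∨ (j.1 + 1 = i.1 ∧ RowMove j σ ρ)

theorem RowRel.unique {n : ℕ} {i j : Fin (n - 1)} {ρ σ σ' : ℕ → ℕ} (h : RowRel i j ρ σ)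
    (h' : RowRel i j ρ σ') : σ = σ' := by
  rcases h with ⟨h, h1⟩ | ⟨h, h1⟩ <;> rcases h' with ⟨h', h2⟩ | ⟨h', h2⟩
  · exact h1.right_unique h2
  · omega
  · omega
  · exact h1.left_unique h2

theorem rowRel_f {n : ℕ} {i j : Fin (n - 1)} (hij : Adjacent i j) (Y : StandardTableau n)
    (hY : Y ∈ D (tableauSystem n).τ i j) :
    RowRel i j Y.row ((tableauSystem n).f i j hij ⟨Y, hY⟩).1.row := by
  obtain ⟨h1, h2⟩ := (existsUnique_tableau hij ⟨Y, hY⟩).choose_spec.1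
  rcases id hij with h | h
  · exact Or.inl ⟨h, rowMove_of_relabel h hY h1 h2⟩
  · exact Or.inr ⟨h, rowMove_of_relabel h h1 hY (h2.symm.imp relabel_symm relabel_symm)⟩

/-! ### Standard tableaux are determined by their row words -/

/-- Rows are left-justified and increasing, so the boxes to the left of `k` are exactly those of the
smaller labels in its row. Thus the row word determines the columns as well. -/
theorem StandardTableau.col_eq {n : ℕ} (Y : StandardTableau n) (k : Fin n) :
    (Y.box k).2 = (Finset.univ.filter fun l => l < k ∧ (Y.box l).1 = (Y.box k).1).card := by
  rw [← Finset.card_range (Y.box k).2]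
  symm
  refine Finset.card_bij (fun l _ => (Y.box l).2) ?_ ?_ ?_
  · intro l hl
    simp only [Finset.mem_filter, Finset.mem_univ, true_and] at hl
    rw [Finset.mem_range]
    by_contra h
    exact absurd (Y.le_of_box_le hl.2.ge (not_lt.mp h)) hl.1.not_ge
  · intro l hl l' hl' h
    simp only [Finset.mem_filter, Finset.mem_univ, true_and] at hl hl'
    exact Y.box_injective (Prod.ext (hl.2.trans hl'.2.symm) h)
  · intro c hc
    rw [Finset.mem_range] at hc
    have hm : ((Y.box k).1, c) ∈ Y.shape := Y.shape.up_left_mem le_rfl hc.le (Y.box_mem k)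
    obtain ⟨l, hl⟩ := Y.exists_label hm
    refine ⟨l, ?_, by rw [hl]⟩
    simp only [Finset.mem_filter, Finset.mem_univ, true_and]
    refine ⟨?_, by rw [hl]⟩
    refine lt_of_le_of_ne (Y.le_of_box_le (by rw [hl]) (by rw [hl]; exact hc.le)) fun h => ?_
    rw [h] at hl
    have := congrArg Prod.snd hl
    simp at this
    omega

theorem Tableau.ext_box {n : ℕ} {T U : Tableau n} (h : ∀ k, T.box k = U.box k) : T = U := by
  have hs : T.shape = U.shape := by
    ext b
    simp only [YoungDiagram.mem_cells]
    constructor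
    · intro hb
      obtain ⟨k, rfl⟩ := T.exists_label hb
      exact h k ▸ U.box_mem k
    · intro hb
      obtain ⟨k, rfl⟩ := U.exists_label hb
      exact h k ▸ T.box_mem k
  obtain ⟨S, f⟩ := T
  obtain ⟨S', g⟩ := U
  obtain rfl : S = S' := hs
  have : f.symm = g.symm := Equiv.ext fun k => Subtype.ext (h k)
  rw [← f.symm_symm, this, g.symm_symm]

theorem StandardTableau.row_injective {n : ℕ} :
    Function.Injective (StandardTableau.row (n := n)) := by
  intro Y Z h
  have h1 : ∀ k, (Y.box k).1 = (Z.box k).1 := fun k => by rw [← Y.row_coe, ← Z.row_coe, h]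
  refine StandardTableau.eq_of_toTableau (Tableau.ext_box fun k => Prod.ext (h1 k) ?_)
  rw [Y.col_eq, Z.col_eq]
  simp only [h1]

/-! ### Generalized `τ`-invariants of recording tableaux -/

/-- `s_i ∈ τ(x⁻¹)` iff the one-line notation of `x` has a descent at `i`. -/
theorem mem_permTau_inv {n : ℕ} {i : Fin (n - 1)} {x : Equiv.Perm (Fin n)} :
    i ∈ permTau x⁻¹ ↔ x (hi i) < x (lo i) := by
  rw [mem_permTau, inv_inv]

theorem row_recordingTableau {n : ℕ} (x : Equiv.Perm (Fin n)) (k : Fin n) :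
    (recordingTableau x).row k = insertIndex (x k) (prefixRows x k) := by
  rw [StandardTableau.row_coe, box_recordingTableau]

/-- Two consecutive insertions end in a strictly lower row the second time exactly when the second
letter is smaller. -/
theorem tableauTau_recordingTableau {n : ℕ} (x : Equiv.Perm (Fin n)) :
    tableauTau (recordingTableau x) = permTau x⁻¹ := by
  ext i
  have h1 : (recordingTableau x).row i = _ := row_recordingTableau x (lo i)
  have h2 : (recordingTableau x).row (i + 1) = _ := row_recordingTableau x (hi i)
  have h3 : prefixRows x (hi i) = _ := prefixRows_succ x (lo i)
  rw [mem_tableauTau, mem_permTau_inv, h1, h2, h3]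
  constructor
  · intro h
    by_contra hn
    have hlt : x (lo i) < x (hi i) :=
      lt_of_le_of_ne (not_lt.mp hn) fun he => lo_ne_hi i (x.injective he)
    exact absurd (insertIndex_le_of_lt hlt (prefixRows_spec x (lo i) (lo i).2.le).1) h.not_ge
  · exact fun h => insertIndex_lt_of_gt h _

/-- Right multiplication by a simple transposition exchanges two neighbouring entries of the
one-line notation, and the conditions on descents make this an elementary Knuth transformation of
the three entries at `lo i`, `hi i`, `hi j`. The Knuth lemmas describe the row indices inside this
window. -/
theorem rowMove_recordingTableau {n : ℕ} {i j : Fin (n - 1)} {x x' : Equiv.Perm (Fin n)}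
    (hij : i.1 + 1 = j.1) (hx : x⁻¹ ∈ D permTau i j) (hx' : x'⁻¹ ∈ D permTau j i)
    (h : x' = x * s i ∨ x' = x * s j) :
    RowMove i (recordingTableau x).row (recordingTableau x').row := by
  have e : lo j = hi i := Fin.ext hij.symm
  have hlo : (lo i).1 = i := rfl
  have hhi : (hi i).1 = i + 1 := rfl
  have hhj : (hi j).1 = i + 2 := by simp [hi, ← hij]
  have hn : i.1 + 2 < n := hhj ▸ (hi j).2
  have hsame : ∀ k : Fin n, k.1 < i ∨ i.1 + 3 ≤ k → x k = x' k := by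
    intro k hk
    have h1 : k ≠ lo i := fun h => by rw [h] at hk; omega
    have h2 : k ≠ hi i := fun h => by rw [h] at hk; omega
    have h3 : k ≠ hi j := fun h => by rw [h] at hk; omega
    rcases h with rfl | rfl
    · rw [Equiv.Perm.mul_apply, s, Equiv.swap_apply_of_ne_of_ne h1 h2]
    · rw [Equiv.Perm.mul_apply, s, Equiv.swap_apply_of_ne_of_ne (e ▸ h2) h3]
  have hP : prefixRows x i = prefixRows x' i :=
    prefixRows_congr (Nat.zero_le _) rfl fun k _ hk => hsame k (Or.inl hk)
  obtain ⟨P, hPd⟩ : ∃ P, P = prefixRows x i := ⟨_, rfl⟩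
  obtain ⟨hs, hnd, hmem⟩ := prefixRows_spec x i (by omega)
  have step : ∀ y : Equiv.Perm (Fin n), prefixRows y i = P →
      prefixRows y (i + 1) = insertRows (y (lo i)) P ∧
      prefixRows y (i + 2) = insertRows (y (hi i)) (insertRows (y (lo i)) P) ∧
      prefixRows y (i + 3) =
        insertRows (y (hi j)) (insertRows (y (hi i)) (insertRows (y (lo i)) P)) := by
    intro y hy
    have h1 : prefixRows y (i + 1) = _ := prefixRows_succ y (lo i)
    have h2 : prefixRows y (i + 2) = _ := prefixRows_succ y (hi i)
    have h3 : prefixRows y (i + 3) = insertRows (y (hi j)) (prefixRows y (i + 2)) := by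
      have := prefixRows_succ y (hi j)
      rwa [hhj] at this
    rw [hhi] at h2
    rw [hlo] at h1
    rw [h3, h2, h1, hy]
    exact ⟨rfl, rfl, rfl⟩
  have rows : ∀ y : Equiv.Perm (Fin n), prefixRows y i = P →
      (recordingTableau y).row i = insertIndex (y (lo i)) P ∧
      (recordingTableau y).row (i + 1) = insertIndex (y (hi i)) (insertRows (y (lo i)) P) ∧
      (recordingTableau y).row (i + 2) =
        insertIndex (y (hi j)) (insertRows (y (hi i)) (insertRows (y (lo i)) P)) := by
    intro y hy
    obtain ⟨s1, s2, s3⟩ := step y hy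
    have h1 : (recordingTableau y).row i = _ := row_recordingTableau y (lo i)
    have h2 : (recordingTableau y).row (i + 1) = _ := row_recordingTableau y (hi i)
    have h3 : (recordingTableau y).row (i + 2) = insertIndex (y (hi j)) (prefixRows y (i + 2)) := by
      have := row_recordingTableau y (hi j)
      rwa [hhj] at this
    rw [hhi] at h2
    rw [hlo] at h1
    rw [h1, h2, h3, hy, s1, s2]
    exact ⟨rfl, rfl, rfl⟩
  obtain ⟨r1, r2, r3⟩ := rows x hPd.symm
  obtain ⟨r1', r2', r3'⟩ := rows x' (hP ▸ hPd.symm)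
  obtain ⟨-, -, t3⟩ := step x hPd.symm
  obtain ⟨-, -, t3'⟩ := step x' (hP ▸ hPd.symm)
  rw [← hPd] at hs hnd hmem
  simp only [D, Set.mem_ofPred_eq, mem_permTau_inv, e, not_lt] at hx hx'
  have ne : ∀ {y : Equiv.Perm (Fin n)} {k l : Fin n}, k.1 ≠ l.1 → y k ≠ y l :=
    fun hkl h => hkl (congrArg Fin.val (Equiv.injective _ h))
  have ab : x (hi i) < x (lo i) := hx.1
  have bc : x (hi i) < x (hi j) := lt_of_le_of_ne hx.2 (ne (by omega))
  -- Outside the window the insertions agree: before it since the prefixes agree, after it since the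
  -- rows agree at its end.
  have hother : ∀ m, m < i.1 ∨ i.1 + 3 ≤ m → prefixRows x (i + 3) = prefixRows x' (i + 3) →
      (recordingTableau x').row m = (recordingTableau x).row m := by
    intro m hm h3
    by_cases hmn : m < n
    · have h1 : (recordingTableau x).row m = _ := row_recordingTableau x ⟨m, hmn⟩
      have h2 : (recordingTableau x').row m = _ := row_recordingTableau x' ⟨m, hmn⟩
      rw [h1, h2, hsame ⟨m, hmn⟩ hm]
      congr 1
      rcases hm with hm | hm
      · exact prefixRows_congr (Nat.zero_le m) rfl fun k _ hk =>
          (hsame k (Or.inl (hk.trans hm))).symm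
      · exact prefixRows_congr hm h3.symm fun k hk _ => (hsame k (Or.inr hk)).symm
    · simp [StandardTableau.row, hmn]
  -- Exchanging the first two entries turns the pattern `z x y` into `x z y`; exchanging the last
  -- two turns `y x z` into `y z x`.
  rcases h with h | h
  · have e1 : x' (lo i) = x (hi i) := by simp [h, s]
    have e2 : x' (hi i) = x (lo i) := by simp [h, s]
    have e3 : x' (hi j) = x (hi j) := by
      rw [h, Equiv.Perm.mul_apply, s, Equiv.swap_apply_of_ne_of_ne]
      · exact fun h => by rw [Fin.ext_iff] at h; omega
      · exact fun h => by rw [Fin.ext_iff] at h; omega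
    simp only [e1, e2, e3] at r1' r2' r3' t3'
    rw [e2, e3] at hx'
    have hnd' : (x (lo i) :: P.flatten).Nodup := List.nodup_cons.mpr ⟨hmem (lo i) le_rfl, hnd⟩
    obtain ⟨k1, k2⟩ := insertRows_knuth_right bc hx'.1 hs hnd'
    refine ⟨?_, fun m hm => hother m hm (by rw [t3, t3', k1])⟩
    rw [TripleMove, r1, r2, r3, r1', r2', r3']
    have l1 := insertIndex_le_of_lt ab hs
    have hs' := insertRows_sorted hs (List.nodup_cons.mpr ⟨hmem (hi i) (by omega), hnd⟩)
    have l2 := insertIndex_lt_of_gt hx'.1 (insertRows (x (hi i)) P)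
    have l3 := insertIndex_lt_of_gt ab P
    omega
  · have e1 : x' (lo i) = x (lo i) := by
      rw [h, Equiv.Perm.mul_apply, s, e, Equiv.swap_apply_of_ne_of_ne]
      · exact fun h => by rw [Fin.ext_iff] at h; omega
      · exact fun h => by rw [Fin.ext_iff] at h; omega
    have e2 : x' (hi i) = x (hi j) := by simp [h, s, e]
    have e3 : x' (hi j) = x (hi i) := by simp [h, s, e]
    simp only [e1, e2, e3] at r1' r2' r3' t3'
    rw [e1, e2] at hx'
    have ac : x (lo i) < x (hi j) := lt_of_le_of_ne hx'.2 (ne (by omega))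
    obtain ⟨k1, k2, k3⟩ := insertRows_knuth_left ab ac hs
    refine ⟨?_, fun m hm => hother m hm (by rw [t3, t3', k1])⟩
    rw [TripleMove, r1, r2, r3, r1', r2', r3', k2, k3]
    have l1 := insertIndex_le_of_lt ac hs
    have l3 := insertIndex_lt_of_gt ab P
    omega

theorem rowRel_recordingTableau {n : ℕ} {i j : Fin (n - 1)} (hij : Adjacent i j)
    (y : Equiv.Perm (Fin n)) (hy : y ∈ D (permSystem n).τ i j) :
    RowRel i j (recordingTableau y⁻¹).row
      (recordingTableau ((permSystem n).f i j hij ⟨y, hy⟩).1⁻¹).row := by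
  obtain ⟨h1, h2⟩ := (existsUnique_perm hij ⟨y, hy⟩).choose_spec.1
  have hz : ((permSystem n).f i j hij ⟨y, hy⟩).1 = (existsUnique_perm hij ⟨y, hy⟩).choose := rfl
  rw [← hz] at h1 h2
  generalize ((permSystem n).f i j hij ⟨y, hy⟩).1 = z at h1 h2
  rcases id hij with h | h
  · refine Or.inl ⟨h, rowMove_recordingTableau h (by rwa [inv_inv]) (by rwa [inv_inv]) ?_⟩
    exact h2.imp (fun h => by rw [h, mul_inv_rev, s_inv]) (fun h => by rw [h, mul_inv_rev, s_inv])
  · refine Or.inr ⟨h, rowMove_recordingTableau h (by rwa [inv_inv]) (by rwa [inv_inv]) ?_⟩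
    refine h2.symm.imp (fun h => ?_) (fun h => ?_)
    · rw [h, mul_inv_rev, s_inv, mul_assoc, s, Equiv.swap_mul_self, mul_one]
    · rw [h, mul_inv_rev, s_inv, mul_assoc, s, Equiv.swap_mul_self, mul_one]

/-- The move of row words is deterministic and row words determine tableaux, so `f_{i,j}` of `Q(x)`
is itself a recording tableau, that of the inverse of `f_{i,j}(x⁻¹)`. The induction on the order
therefore runs over all permutations at once. -/
theorem sameGenTau_recordingTableau {n : ℕ} (x : Equiv.Perm (Fin n)) :
    SameGenTau (tableauSystem n) (permSystem n) (recordingTableau x) x⁻¹ := by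
  intro m
  induction m generalizing x with
  | zero => exact tableauTau_recordingTableau x
  | succ m ih =>
    refine ⟨ih x, fun i j hij h h' => ?_⟩
    have h1 := rowRel_f hij (recordingTableau x) h
    have h2 := rowRel_recordingTableau hij x⁻¹ h'
    rw [inv_inv] at h2
    rw [StandardTableau.row_injective (h1.unique h2)]
    simpa using ih ((permSystem n).f i j hij ⟨x⁻¹, h'⟩).1⁻¹

/-! ### Ballot words -/

/-- Each number occurs in `l` at least as often as its successor. -/
def IsDominant (l : List ℕ) : Prop := ∀ r, l.count (r + 1) ≤ l.count r

/-- All terminal segments of `l` are dominant; that is, `l` read from right to left is a ballot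
word. -/
def IsBallot : List ℕ → Prop
  | [] => True
  | a :: l => IsDominant (a :: l) ∧ IsBallot l

theorem IsBallot.isDominant {l : List ℕ} (h : IsBallot l) : IsDominant l := by
  cases l with
  | nil => simp [IsDominant]
  | cons a l => exact h.1

theorem IsDominant.perm {l l' : List ℕ} (h : IsDominant l) (hl : l.Perm l') : IsDominant l' :=
  fun r => by rw [← hl.count_eq, ← hl.count_eq]; exact h r

/-- The head is a largest letter `a`, and its removal can only endanger the comparison with `a + 1`,
which does not occur. -/
theorem IsDominant.isBallot_of_pairwise {l : List ℕ} (h : IsDominant l)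
    (hl : l.Pairwise (· ≥ ·)) : IsBallot l := by
  induction l with
  | nil => trivial
  | cons a l ih =>
    rw [List.pairwise_cons] at hl
    refine ⟨h, ih (fun r => ?_) hl.2⟩
    have := h r
    simp only [List.count_cons, beq_iff_eq] at this
    by_cases hr : a = r
    · have : l.count (r + 1) = 0 := List.count_eq_zero.mpr fun hm => by
        have := hl.1 _ hm
        omega
      omega
    · rw [if_neg hr] at this
      omega

/-- Removing one `e` keeps the content dominant by the strict inequality; the remaining letters are
put in decreasing order. -/
theorem exists_isBallot_cons {l : List ℕ} {e : ℕ} (h : IsDominant l)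
    (he : l.count (e + 1) < l.count e) : ∃ t, IsBallot (e :: t) ∧ (e :: t).Perm l := by
  have hp : l.Perm (e :: l.erase e) :=
    List.perm_cons_erase (List.count_pos_iff.mp (by omega))
  have hd : IsDominant (l.erase e) := fun r => by
    have h1 := h r
    rw [hp.count_eq, hp.count_eq, List.count_cons, List.count_cons] at h1 he
    simp only [beq_iff_eq, Nat.left_eq_add, one_ne_zero, if_false, if_true, add_zero] at he h1
    by_cases hr : e = r
    · subst hr
      omega
    · rw [if_neg hr] at h1
      omega
  have hs : ((l.erase e).insertionSort (· ≥ ·)).Perm (l.erase e) := List.perm_insertionSort _ _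
  refine ⟨(l.erase e).insertionSort (· ≥ ·), ⟨h.perm (hp.trans (hs.symm.cons _)), ?_⟩,
    (hs.cons _).trans hp.symm⟩
  exact (hd.perm hs.symm).isBallot_of_pairwise (List.pairwise_insertionSort _ _)

/-- Two words, read from right to left, differ by a `TripleMove`, in either direction, of three
consecutive letters. -/
inductive WordMove : List ℕ → List ℕ → Prop
  | head {p q r p' q' r' : ℕ} (w : List ℕ) (h : TripleMove p q r p' q' r') :
      WordMove (r :: q :: p :: w) (r' :: q' :: p' :: w)
  | head_symm {p q r p' q' r' : ℕ} (w : List ℕ) (h : TripleMove p' q' r' p q r) :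
      WordMove (r :: q :: p :: w) (r' :: q' :: p' :: w)
  | cons (a : ℕ) {w w' : List ℕ} (h : WordMove w w') : WordMove (a :: w) (a :: w')

theorem WordMove.symm {w w' : List ℕ} (h : WordMove w w') : WordMove w' w := by
  induction h with
  | head w h => exact .head_symm w h
  | head_symm w h => exact .head w h
  | cons a _ ih => exact .cons a ih

/-- The words that can be reached from `w` by moves. -/
abbrev WordPath : List ℕ → List ℕ → Prop := Relation.ReflTransGen WordMove

theorem WordPath.symm {w w' : List ℕ} (h : WordPath w w') : WordPath w' w :=
  haveI : Std.Symm WordMove := ⟨fun _ _ => WordMove.symm⟩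
  Std.Symm.symm _ _ h

theorem WordPath.cons (a : ℕ) {w w' : List ℕ} (h : WordPath w w') : WordPath (a :: w) (a :: w') :=
  Relation.ReflTransGen.lift (a :: ·) (fun _ _ => WordMove.cons a) _ _ h

/-- Ballot words with the same content are connected by moves. -/
theorem IsBallot.wordPath {u v : List ℕ} (hu : IsBallot u) (hv : IsBallot v) (huv : u.Perm v) :
    WordPath u v := by
  induction hm : u.length generalizing u v with
  | zero =>
    obtain rfl := List.length_eq_zero_iff.mp hm
    rw [huv.symm.eq_nil]
  | succ m ih =>
    rcases u with _ | ⟨a, u⟩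
    · simp at hm
    rcases v with _ | ⟨b, v⟩
    · simpa using huv.length_eq
    simp only [List.length_cons, Nat.add_right_cancel_iff] at hm
    -- For heads `a < b = e + 1`, both words are brought to words that begin with `a` and `b` in the
    -- two orders, followed by a common ballot word `e :: t`. The letter `e` in third place permits
    -- the exchange of `a` and `b` by one move, since `a ≤ e < b`.
    have key : ∀ {a b : ℕ} {u v : List ℕ}, IsBallot (a :: u) → IsBallot (b :: v) →
        (a :: u).Perm (b :: v) → u.length = m → a < b → WordPath (a :: u) (b :: v) := by
      clear huv hm hu hv a b u v
      intro a b u v hu hv huv hm hab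
      obtain ⟨e, rfl⟩ : ∃ e, b = e + 1 := ⟨b - 1, by omega⟩
      have hb : e + 1 ∈ u := by
        rcases List.mem_cons.mp (huv.mem_iff.mpr List.mem_cons_self) with h | h
        · omega
        · exact h
      have hpu := List.perm_cons_erase hb
      set l := u.erase (e + 1)
      have hpv : v.Perm (a :: l) :=
        ((huv.symm.trans (hpu.cons a)).trans (List.Perm.swap _ _ _)).cons_inv
      have d0 := hu.1.perm (hpu.cons a)
      have d1 := hu.2.isDominant.perm hpu
      have d2 := hv.2.isDominant.perm hpv
      -- Putting back `e + 1` keeps the content dominant, which gives every comparison except that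
      -- of `e + 1` with `e + 2`; putting back `a < e + 1` gives this one.
      have hd : IsDominant l := fun r => by
        have h0 := d0 r
        have h1 := d1 r
        have h2 := d2 r
        simp only [List.count_cons, beq_iff_eq] at h0 h1 h2
        split_ifs at h0 h1 h2 <;> omega
      have he : l.count (e + 1) < l.count e := by
        have h0 := d0 e
        have h1 := d1 e
        simp only [List.count_cons, beq_iff_eq] at h0 h1
        split_ifs at h0 h1 <;> omega
      obtain ⟨t, ht, htl⟩ := exists_isBallot_cons hd he
      have p1 : u.Perm ((e + 1) :: e :: t) := hpu.trans (htl.symm.cons _)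
      have p2 : v.Perm (a :: e :: t) := hpv.trans (htl.symm.cons _)
      have c1 : WordPath u ((e + 1) :: e :: t) :=
        ih hu.2 ⟨hu.2.isDominant.perm p1, ht⟩ p1 hm
      have c2 : WordPath (a :: e :: t) v := by
        refine ih ⟨hv.2.isDominant.perm p2, ht⟩ hv.2 p2.symm ?_
        rw [← p2.length_eq, ← hm]
        simpa using huv.length_eq.symm
      have mv : WordMove (a :: (e + 1) :: e :: t) ((e + 1) :: a :: e :: t) :=
        .head t (by unfold TripleMove; omega)
      exact ((c1.cons a).tail mv).trans (c2.cons _)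
    rcases lt_trichotomy a b with h | rfl | h
    · exact key hu hv huv hm h
    · exact (ih hu.2 hv.2 huv.cons_inv hm).cons a
    · refine (key hv hu huv.symm ?_ h).symm
      rw [← hm]
      simpa using huv.length_eq.symm

/-! ### The row word of a standard tableau -/

/-- The first `m` letters of the word `ρ`, from right to left. -/
def rowWord (ρ : ℕ → ℕ) : ℕ → List ℕ
  | 0 => []
  | m + 1 => ρ m :: rowWord ρ m

theorem length_rowWord (ρ : ℕ → ℕ) (m : ℕ) : (rowWord ρ m).length = m := by
  induction m with
  | zero => rfl
  | succ m ih => simp [rowWord, ih]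

theorem rowWord_congr {ρ σ : ℕ → ℕ} {m : ℕ} (h : ∀ k < m, ρ k = σ k) :
    rowWord ρ m = rowWord σ m := by
  induction m with
  | zero => rfl
  | succ m ih => rw [rowWord, rowWord, h m m.lt_succ_self, ih fun k hk => h k (by omega)]

theorem eq_of_rowWord_eq {ρ σ : ℕ → ℕ} {m : ℕ} (h : rowWord ρ m = rowWord σ m) :
    ∀ k < m, ρ k = σ k := by
  induction m with
  | zero => simp
  | succ m ih =>
    simp only [rowWord, List.cons.injEq] at h
    intro k hk
    rcases Nat.lt_succ_iff_lt_or_eq.mp hk with hk | rfl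
    · exact ih h.2 k hk
    · exact h.1

theorem StandardTableau.count_rowWord {n : ℕ} (Y : StandardTableau n) (r m : ℕ) (hm : m ≤ n) :
    (rowWord Y.row m).count r =
      (Finset.univ.filter fun k : Fin n => k < m ∧ (Y.box k).1 = r).card := by
  induction m with
  | zero => simp [rowWord]
  | succ m ih =>
    have hrow : Y.row m = (Y.box ⟨m, hm⟩).1 := Y.row_coe ⟨m, hm⟩
    rw [rowWord, List.count_cons, ih (by omega), hrow]
    by_cases h : (Y.box ⟨m, hm⟩).1 = r
    · have : (Finset.univ.filter fun k : Fin n => k < m + 1 ∧ (Y.box k).1 = r) =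
          insert ⟨m, hm⟩ (Finset.univ.filter fun k : Fin n => k < m ∧ (Y.box k).1 = r) := by
        ext k
        simp only [Finset.mem_filter, Finset.mem_univ, true_and, Finset.mem_insert, Fin.ext_iff,
          Nat.lt_succ_iff_lt_or_eq]
        constructor
        · rintro ⟨h1 | h1, h2⟩
          · exact Or.inr ⟨h1, h2⟩
          · exact Or.inl h1
        · rintro (h1 | ⟨h1, h2⟩)
          · have : k = ⟨m, hm⟩ := Fin.ext h1
            exact ⟨Or.inr h1, this ▸ h⟩
          · exact ⟨Or.inl h1, h2⟩
      rw [this, Finset.card_insert_of_notMem (by simp)]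
      simp [h]
    · simp only [h, beq_iff_eq, if_false, add_zero]
      congr 1
      ext k
      simp only [Finset.mem_filter, Finset.mem_univ, true_and, Nat.lt_succ_iff_lt_or_eq]
      refine ⟨fun h1 => ⟨Or.inl h1.1, h1.2⟩, ?_⟩
      rintro ⟨h1 | h1, h2⟩
      · exact ⟨h1, h2⟩
      · have : k = ⟨m, hm⟩ := Fin.ext h1
        exact absurd (this ▸ h2) h

/-- The box directly above a box of row `r + 1` has a smaller label, so among the labels below `m`
the columns met by row `r + 1` are also met by row `r`. -/
theorem StandardTableau.isDominant_rowWord {n : ℕ} (Y : StandardTableau n) (m : ℕ) (hm : m ≤ n) :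
    IsDominant (rowWord Y.row m) := by
  intro r
  have hinj : ∀ r, Set.InjOn (fun k => (Y.box k).2)
      (Finset.univ.filter fun k : Fin n => k < m ∧ (Y.box k).1 = r) := by
    intro r k hk l hl h
    simp only [Finset.coe_filter, Finset.mem_univ, true_and, Set.mem_ofPred_eq] at hk hl
    exact Y.box_injective (Prod.ext (hk.2.trans hl.2.symm) h)
  rw [Y.count_rowWord _ _ hm, Y.count_rowWord _ _ hm, ← Finset.card_image_of_injOn (hinj r),
    ← Finset.card_image_of_injOn (hinj (r + 1))]
  refine Finset.card_le_card fun c hc => ?_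
  simp only [Finset.mem_image, Finset.mem_filter, Finset.mem_univ, true_and] at hc ⊢
  obtain ⟨k, ⟨h1, h2⟩, rfl⟩ := hc
  have hb : (r, (Y.box k).2) ∈ Y.shape :=
    Y.shape.up_left_mem (i2 := (Y.box k).1) (by omega) le_rfl (Y.box_mem k)
  obtain ⟨l, hl⟩ := Y.exists_label hb
  refine ⟨l, ⟨?_, by rw [hl]⟩, by rw [hl]⟩
  have : l ≤ k := Y.le_of_box_le (by rw [hl, h2]; exact Nat.le_succ r) (by rw [hl])
  exact lt_of_le_of_lt this h1

theorem StandardTableau.isBallot_rowWord {n : ℕ} (Y : StandardTableau n) (m : ℕ) (hm : m ≤ n) :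
    IsBallot (rowWord Y.row m) := by
  induction m with
  | zero => trivial
  | succ m ih => exact ⟨Y.isDominant_rowWord (m + 1) hm, ih (by omega)⟩

/-- A move of the row word of a tableau is realized by one of the maps `f_{i,j}`. -/
theorem WordMove.exists_f {n : ℕ} {w w' : List ℕ} (h : WordMove w w') (hn : w.length ≤ n) :
    ∃ (i j : Fin (n - 1)) (hij : Adjacent i j), ∀ Y : StandardTableau n,
      rowWord Y.row w.length = w → ∃ hY : Y ∈ D (tableauSystem n).τ i j,
        rowWord ((tableauSystem n).f i j hij ⟨Y, hY⟩).1.row w.length = w' ∧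
        ∀ k, w.length ≤ k → ((tableauSystem n).f i j hij ⟨Y, hY⟩).1.row k = Y.row k := by
  induction h with
  | @head p q r p' q' r' t h =>
    simp only [List.length_cons] at hn
    obtain ⟨k, hk⟩ : ∃ k, k = t.length := ⟨_, rfl⟩
    rw [← hk] at hn
    -- The word is read from the right, so `p`, `q`, `r` are the rows of the labels `k`, `k + 1`, `k
    -- + 2`. The indices depend on the move only, so one and the same map serves all tableaux with
    -- this word.
    refine ⟨⟨k, by omega⟩, ⟨k + 1, by omega⟩, Or.inl rfl, fun Y hY => ?_⟩
    simp only [List.length_cons, ← hk, rowWord, List.cons.injEq] at hY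
    obtain ⟨h3, h2, h1, h0⟩ := hY
    have hD : Y ∈ D (tableauSystem n).τ ⟨k, by omega⟩ ⟨k + 1, by omega⟩ := by
      refine ⟨mem_tableauTau.mpr ?_, fun hj => absurd (mem_tableauTau.mp hj) ?_⟩
      · simp only [h1, h2]; exact h.1.1
      · simp only [h2, h3]; exact h.1.2.not_gt
    refine ⟨hD, ?_⟩
    rcases rowRel_f (Or.inl rfl) Y hD with ⟨-, hm⟩ | ⟨hm, -⟩
    · obtain ⟨hm, hsame⟩ := hm
      simp only [h1, h2, h3] at hm
      simp only [List.length_cons, ← hk, rowWord]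
      refine ⟨?_, fun l hl => hsame l (Or.inr hl)⟩
      rw [rowWord_congr fun l hl => hsame l (Or.inl hl), h0]
      unfold TripleMove at h hm
      congr 1
      · omega
      congr 1
      · omega
      congr 1
      omega
    · exact absurd hm (by simp; omega)
  | @head_symm p q r p' q' r' t h =>
    simp only [List.length_cons] at hn
    obtain ⟨k, hk⟩ : ∃ k, k = t.length := ⟨_, rfl⟩
    rw [← hk] at hn
    refine ⟨⟨k + 1, by omega⟩, ⟨k, by omega⟩, Or.inr rfl, fun Y hY => ?_⟩
    simp only [List.length_cons, ← hk, rowWord, List.cons.injEq] at hY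
    obtain ⟨h3, h2, h1, h0⟩ := hY
    have hD : Y ∈ D (tableauSystem n).τ ⟨k + 1, by omega⟩ ⟨k, by omega⟩ := by
      refine ⟨mem_tableauTau.mpr ?_, fun hj => absurd (mem_tableauTau.mp hj) ?_⟩
      · simp only [h2, h3]; exact h.2.1.2
      · simp only [h1, h2]; exact h.2.1.1.not_gt
    refine ⟨hD, ?_⟩
    rcases rowRel_f (Or.inr rfl) Y hD with ⟨hm, -⟩ | ⟨-, hm⟩
    · exact absurd hm (by simp; omega)
    · obtain ⟨hm, hsame⟩ := hm
      simp only [h1, h2, h3] at hm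
      simp only [List.length_cons, ← hk, rowWord]
      refine ⟨?_, fun l hl => (hsame l (Or.inr hl)).symm⟩
      rw [← rowWord_congr fun l hl => hsame l (Or.inl hl), h0]
      unfold TripleMove at h hm
      congr 1
      · omega
      congr 1
      · omega
      congr 1
      omega
  | cons a h ih =>
    simp only [List.length_cons] at hn
    obtain ⟨i, j, hij, H⟩ := ih (by omega)
    refine ⟨i, j, hij, fun Y hY => ?_⟩
    simp only [List.length_cons, rowWord, List.cons.injEq] at hY ⊢
    obtain ⟨hD, h1, h2⟩ := H Y hY.2
    exact ⟨hD, ⟨(h2 _ le_rfl).trans hY.1, h1⟩, fun k hk => h2 k (by omega)⟩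

/-! ### Completeness of the generalized `τ`-invariant on standard tableaux -/

/-! ### Formal properties of equivalence to order `m`. -/

theorem EquivToOrder.tau_eq {n : ℕ} {Ω Ω' : Type} {A : TauSystem n Ω} {B : TauSystem n Ω'}
    {ω : Ω} {ω' : Ω'} {m : ℕ} (h : EquivToOrder A B m ω ω') : A.τ ω = B.τ ω' := by
  induction m with
  | zero => exact h
  | succ m ih => exact ih h.1

theorem EquivToOrder.symm {n : ℕ} {Ω Ω' : Type} {A : TauSystem n Ω} {B : TauSystem n Ω'}
    {ω : Ω} {ω' : Ω'} {m : ℕ} (h : EquivToOrder A B m ω ω') : EquivToOrder B A m ω' ω := by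
  induction m generalizing ω ω' with
  | zero => exact Eq.symm h
  | succ m ih => exact ⟨ih h.1, fun i j hij hω' hω => ih (h.2 i j hij hω hω')⟩

theorem EquivToOrder.trans {n : ℕ} {Ω Ω' Ω'' : Type} {A : TauSystem n Ω} {B : TauSystem n Ω'}
    {C : TauSystem n Ω''} {ω : Ω} {ω' : Ω'} {ω'' : Ω''} {m : ℕ} (h : EquivToOrder A B m ω ω')
    (h' : EquivToOrder B C m ω' ω'') : EquivToOrder A C m ω ω'' := by
  induction m generalizing ω ω' ω'' with
  | zero => exact Eq.trans h h'
  | succ m ih =>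
    refine ⟨ih h.1 h'.1, fun i j hij hω hω'' => ?_⟩
    -- The intermediate element lies in its `D_{i,j}` because equivalence to any order includes
    -- equality of `τ`.
    have hω' : ω' ∈ D B.τ i j := by
      simpa only [D, Set.mem_ofPred_eq, ← h.tau_eq] using hω
    exact ih (h.2 i j hij hω hω') (h'.2 i j hij hω' hω'')

theorem SameGenTau.f {n : ℕ} {Ω Ω' : Type} {A : TauSystem n Ω} {B : TauSystem n Ω'}
    {ω : Ω} {ω' : Ω'} (h : SameGenTau A B ω ω') {i j : Fin (n - 1)} (hij : Adjacent i j)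
    (hω : ω ∈ D A.τ i j) (hω' : ω' ∈ D B.τ i j) :
    SameGenTau A B (A.f i j hij ⟨ω, hω⟩).1 (B.f i j hij ⟨ω', hω'⟩).1 :=
  fun m => (h (m + 1)).2 i j hij hω hω'

/-- A path that starts at the common prefix is followed by the same maps `f_{i,j}` in both tableaux;
the equality of invariants persists, and the row of the label `m` just after the prefix is
untouched. -/
theorem SameGenTau.exists_of_wordPath {n m : ℕ} {Y Z : StandardTableau n}
    (h : SameGenTau (tableauSystem n) (tableauSystem n) Y Z) (hm : m ≤ n) {w : List ℕ}
    (hw : WordPath (rowWord Y.row m) w) (hYZ : rowWord Y.row m = rowWord Z.row m) :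
    ∃ Y' Z' : StandardTableau n, SameGenTau (tableauSystem n) (tableauSystem n) Y' Z' ∧
      rowWord Y'.row m = w ∧ rowWord Z'.row m = w ∧ Y'.row m = Y.row m ∧ Z'.row m = Z.row m := by
  induction hw with
  | refl => exact ⟨Y, Z, h, rfl, hYZ.symm, rfl, rfl⟩
  | tail _ hmove ih =>
    obtain ⟨Y', Z', h', hY, hZ, eY, eZ⟩ := ih
    have hl := congrArg List.length hY
    rw [length_rowWord] at hl
    obtain ⟨i, j, hij, H⟩ := hmove.exists_f (hl ▸ hm)
    rw [← hl] at H
    obtain ⟨dY, fY, gY⟩ := H Y' hY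
    obtain ⟨dZ, fZ, gZ⟩ := H Z' hZ
    exact ⟨_, _, h'.f hij dY dZ, fY, fZ, (gY m le_rfl).trans eY, (gZ m le_rfl).trans eZ⟩

/-- If `m` lies in row `e + 1` of `Z` and higher up in `Y`, then moving the label before `m` to row
`e` in both tableaux produces an ascent into `m` only on the side of `Z`. -/
theorem SameGenTau.not_row_lt {n m : ℕ} {Y Z : StandardTableau n}
    (h : SameGenTau (tableauSystem n) (tableauSystem n) Y Z) (hm : m < n)
    (hYZ : rowWord Y.row m = rowWord Z.row m) : ¬ Y.row m < Z.row m := by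
  intro hlt
  obtain ⟨e, he⟩ : ∃ e, Z.row m = e + 1 := ⟨Z.row m - 1, by omega⟩
  have hd := Z.isDominant_rowWord (m + 1) hm e
  simp only [rowWord, he, List.count_cons, beq_iff_eq, if_true, Nat.succ_ne_self, if_false] at hd
  -- Dominance of the longer prefix of `Z`, which ends in `e + 1`, says that the common prefix
  -- contains `e` strictly more often than `e + 1`.
  obtain ⟨t, ht, hp⟩ := exists_isBallot_cons (e := e) (Y.isDominant_rowWord m hm.le)
    (by rw [hYZ]; omega)
  obtain ⟨Y', Z', h', hY, hZ, eY, eZ⟩ := h.exists_of_wordPath hm.le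
    ((Y.isBallot_rowWord m hm.le).wordPath ht hp.symm) hYZ
  rcases m with _ | m
  · simp [rowWord] at hY
  · simp only [rowWord, List.cons.injEq] at hY hZ
    have ht : tableauTau Y' = tableauTau Z' := h' 0
    have h1 : (⟨m, by omega⟩ : Fin (n - 1)) ∈ tableauTau Z' :=
      mem_tableauTau.mpr (by simp only [hZ.1, eZ, he]; omega)
    rw [← ht] at h1
    have := mem_tableauTau.mp h1
    simp only [hY.1, eY] at this
    omega

theorem SameGenTau.eq {n : ℕ} {Y Z : StandardTableau n}
    (h : SameGenTau (tableauSystem n) (tableauSystem n) Y Z) : Y = Z := by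
  have key : ∀ m ≤ n, rowWord Y.row m = rowWord Z.row m := by
    intro m hm
    induction m with
    | zero => rfl
    | succ m ih =>
      have hYZ := ih (by omega)
      have h1 := h.not_row_lt hm hYZ
      have h2 := SameGenTau.not_row_lt (fun m => (h m).symm) hm hYZ.symm
      rw [rowWord, rowWord, hYZ, show Y.row m = Z.row m by omega]
  refine StandardTableau.row_injective (funext fun k => ?_)
  by_cases hk : k < n
  · exact eq_of_rowWord_eq (key n le_rfl) k hk
  · simp [StandardTableau.row, hk]

theorem SameGenTau.eq_of_right {n : ℕ} {Ω : Type} {A : TauSystem n Ω} {Y Z : StandardTableau n}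
    {ω : Ω} (hY : SameGenTau (tableauSystem n) A Y ω) (hZ : SameGenTau (tableauSystem n) A Z ω) :
    Y = Z :=
  SameGenTau.eq fun m => (hY m).trans (hZ m).symm

end RSTau

/-- For `x ∈ S_n`, the insertion tableau `P(x)` is the unique standard tableau `Y` with
`τ_g(Y) = τ_g(x)`, and the recording tableau `Q(x)` is the unique standard tableau `Y` with
`τ_g(Y) = τ_g(x⁻¹)`. -/
theorem mainTheorem6 (n : ℕ) (x : Equiv.Perm (Fin n)) :
    (RSTau.SameGenTau (RSTau.tableauSystem n) (RSTau.permSystem n) (RSTau.insertionTableau x) x ∧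
      ∀ Y : RSTau.StandardTableau n,
        RSTau.SameGenTau (RSTau.tableauSystem n) (RSTau.permSystem n) Y x →
          Y = RSTau.insertionTableau x) ∧
    (RSTau.SameGenTau (RSTau.tableauSystem n) (RSTau.permSystem n)
        (RSTau.recordingTableau x) x⁻¹ ∧
      ∀ Y : RSTau.StandardTableau n,
        RSTau.SameGenTau (RSTau.tableauSystem n) (RSTau.permSystem n) Y x⁻¹ →
          Y = RSTau.recordingTableau x) := by
  have hP : RSTau.SameGenTau (RSTau.tableauSystem n) (RSTau.permSystem n)
      (RSTau.insertionTableau x) x := by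
    -- The claim for `P(x)` is the claim for `Q` at the inverse permutation.
    have := RSTau.sameGenTau_recordingTableau x⁻¹
    rwa [inv_inv, ← RSTau.insertionTableau_eq] at this
  have hQ := RSTau.sameGenTau_recordingTableau x
  exact ⟨⟨hP, fun Y hY => hY.eq_of_right hP⟩, ⟨hQ, fun Y hY => hY.eq_of_right hQ⟩⟩
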